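/- **Setting.** Let $F|K$ be a field extension and $P$ a place of $F$ with valuation ring $\mathcal O_P$, maximal ideal $\mathcal M_P$ and valuation $v_P$; write $aP$ for the residue of $a$, and $KP\subseteq FP$, $v_PK\subseteq v_PF$ for the residue fields and value groups. Assume **(T)** there is a transcendence basis $(x_1,\dots,x_\rho,y_1,\dots,y_\tau)$ of $F|K$, with all $y_j\in\mathcal O_P$, such that $F=K(x_1,\dots,x_\rho,y_1,\dots,y_\tau)$, the residues $y_1P,\dots,y_\tau P$ are algebraically independent over $KP$, $FP=KP(y_1P,\dots,y_\tau P)$, and $v_PF=v_PK\oplus\mathbb Z v_Px_1\oplus\dots\oplus\mathbb Z v_Px_\rho$. Let $R\subseteq K$ be a regular local ring with $\operatorname{Frac}R=K$ that is universally catenary and dominated by $\mathcal O_P$ (i.e. $R\subseteq\mathcal O_P$ and $\mathcal M_P\cap R$ is the maximal ideal of $R$); $R=K$ is allowed. For a local ring $S\subseteq K$ dominated by $\mathcal O_P$ and a prime $\mathfrak p$ of $S$ of height $\ge 1$, the *monoidal transform* of $S$ along $v_P|_K$ with center $\mathfrak p$ is the localization of $S[x^{-1}\mathfrak p]$ at $\mathcal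 M_P\cap S[x^{-1}\mathfrak p]$, where $x\in\mathfrak p$ has least value $v_Px$ among the elements of $\mathfrak p$. An *iterated monoidal transform* is the result of finitely many (possibly zero) such steps. For a commutative ring $O$ and $H\subseteq O$, an *$O$-monomial in $H$* is a product of a unit of $O$ and finitely many powers (with exponents in $\mathbb N_0$) of elements of $H$. A *regular parameter system* of a $d$-dimensional regular local ring is a $d$-tuple generating its maximal ideal. Let $Z\subset\mathcal O_P$ be a finite set such that $(R,Z)$ satisfies: **(NC)** There are an iterated monoidal transform $S$ of $R$ along $v_P|_K$ that is a regular local ring, and a regular parameter system $(t_1,\dots,t_d)$ of $S$, such that every $\zeta\in Z$ is a quotient $f_\zeta(x,y)/g_\zeta(x,y)$ of nonzero polynomials $f_\zeta,g_\zeta$ over $S$ in $\rho+\tau$ variables, evaluated at $(x_1,\dots,x_\rho,y_1,\dots,y_\tau)$, all of whose nonzero coefficients are $S$-monomials in $\{t_1,\dots,t_d\}$ (in particular $0\notin Z$). **(V)** For these choices, the values $v_Pt_i$ of those $t_i$ that occur in the prime factorization of at least one nonzero coefficient of the $f_\zeta,g_\zeta$ are rationally independent. Let $\delta$ be the number of these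 $t_i$. **Theorem.** There exist an iterated monoidal transform $R'$ of $R$ along $v_P|_K$ which is a regular local ring, with $\delta\le\dim R'$, and elements $x'_1,\dots,x'_{\rho+\delta}\in\mathcal O_P$ such that for $$A:=R'[x'_1,\dots,x'_{\rho+\delta},y_1,\dots,y_\tau]\subseteq\mathcal O_P,\qquad q:=\mathcal M_P\cap A,$$ the local ring $A_q$ is regular, $\dim A_q=\dim R'+\rho$, the elements $x'_1,\dots,x'_{\rho+\delta}$ are part of a regular parameter system of $A_q$, $Z\subset A_q$, and every element of $Z$ is an $A_q$-monomial in $\{x'_1,\dots,x'_{\rho+\delta}\}$. In particular, there is an $R$-model $X$ of $F$ (an integral separated $R$-scheme of finite type with field of rational functions $F$) such that $P$ is centered in a regular point $x\in X$ with $Z\subset\mathcal O_{X,x}$ and $\dim\mathcal O_{X,x}\le\dim R+\rho$. Moreover, if $R=K$, then such a model can be chosen with $X\cong\mathbb A_K^{\rho+\tau}$ (over $K$) and $\dim\mathcal O_{X,x}=\rho$. -/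

import Mathlib

open AlgebraicGeometry CategoryTheory

universe u

namespace Uniformization

/-! ### Commutative algebra -/

/-- `a` is an `O`-monomial in `H`: a unit of `O` times a finite product of powers of elements
of `H`. -/
def IsMonomialIn {O : Type*} [CommRing O] (H : Set O) (a : O) : Prop :=
  ∃ (w : Oˣ) (d : ℕ) (h : Fin d → O) (μ : Fin d → ℕ),
    (∀ i, h i ∈ H) ∧ a = (w : O) * ∏ i, h i ^ μ i

/-- Two finite non-refinable chains of primes with the same ends have the same length. -/
def IsCatenary (A : Type*) [CommRing A] : Prop :=
  ∀ s s' : LTSeries (PrimeSpectrum A),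
    (∀ i : Fin s.length, s i.castSucc ⋖ s i.succ) →
    (∀ i : Fin s'.length, s' i.castSucc ⋖ s' i.succ) →
    s.head = s'.head → s.last = s'.last → s.length = s'.length

/-- All polynomial rings in finitely many variables are catenary. -/
def IsUniversallyCatenary (A : Type*) [CommRing A] : Prop :=
  ∀ n : ℕ, IsCatenary (MvPolynomial (Fin n) A)

/-- A regular parameter system of a (regular) local ring: `dim S` many generators of the
maximal ideal. -/
def IsRegularParameterSystem {S : Type*} [CommRing S] [IsLocalRing S] {d : ℕ}
    (a : Fin d → S) : Prop :=
  ringKrullDim S = d ∧ Ideal.span (Set.range a) = IsLocalRing.maximalIdeal S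

/-- The elements `a i` (with their indices) form a part of a regular parameter system. -/
def IsPartOfRegularParameterSystem {S : Type*} [CommRing S] [IsLocalRing S] {n : ℕ}
    (a : Fin n → S) : Prop :=
  ∃ (d : ℕ) (b : Fin d → S) (e : Fin n ↪ Fin d),
    IsRegularParameterSystem b ∧ ∀ i, b (e i) = a i

/-! ### Localization at the center of a valuation, monoidal transforms -/

section Valued

variable {K F : Type u} [Field K] [Field F] [Algebra K F]

/-- The contraction `M_V ∩ A` of the maximal ideal of a valuation ring `V` to a subring
`A ⊆ V`. -/
def centerIdeal (V : ValuationSubring F) (A : Subring F) (h : A ≤ V.toSubring) : Ideal A :=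
  (IsLocalRing.maximalIdeal V).comap (Subring.inclusion h : A →+* V)

instance (V : ValuationSubring F) (A : Subring F) (h : A ≤ V.toSubring) :
    (centerIdeal V A h).IsPrime :=
  Ideal.IsPrime.comap (Subring.inclusion h : A →+* V)

/-- The localization of a subring `A ⊆ V` at the prime `M_V ∩ A`, as a subring of the field. -/
noncomputable def localizationAtCenter (V : ValuationSubring F) (A : Subring F)
    (h : A ≤ V.toSubring) : LocalSubring F :=
  LocalSubring.ofPrime A (centerIdeal V A h)

/-- `R₁` is the monoidal transform of `R` along `v` with some center `p`, a prime of height at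
least one: the localization of `R[x⁻¹ p]` at the center of `v`, where `x ∈ p` has the least
value. Mathlib valuations are multiplicative, so the least value is the greatest element of the
value group. -/
def IsMonoidalTransform (v : ValuationSubring K) (R R₁ : LocalSubring K) : Prop :=
  ∃ (p : Ideal R.toSubring) (x : R.toSubring),
    p.IsPrime ∧ 1 ≤ p.height ∧ x ∈ p ∧
    (∀ a ∈ p, v.valuation (a : K) ≤ v.valuation (x : K)) ∧
    ∃ h : Subring.closure ((R.toSubring : Set K) ∪ {b | ∃ a ∈ p, b = (x : K)⁻¹ * (a : K)})
        ≤ v.toSubring,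
      R₁ = localizationAtCenter v _ h

/-- `R'` is reached from `R` by finitely many (possibly zero) monoidal transforms along `v`. -/
def IsIteratedMonoidalTransform (v : ValuationSubring K) (R R' : LocalSubring K) : Prop :=
  Relation.ReflTransGen (IsMonoidalTransform v) R R'

/-! ### Condition (T) -/

/-- The restriction to `K` of the place of `F` with valuation ring `V`. -/
abbrev restrict (K : Type u) {F : Type u} [Field K] [Field F] [Algebra K F]
    (V : ValuationSubring F) : ValuationSubring K :=
  V.comap (algebraMap K F)

/-- The inclusion of the valuation ring of `K` into the valuation ring of `F`. -/
def restrictHom (K : Type u) {F : Type u} [Field K] [Field F] [Algebra K F]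
    (V : ValuationSubring F) : restrict K V →+* V :=
  ((algebraMap K F).comp (restrict K V).subtype).codRestrict V (fun a => a.2)

instance (V : ValuationSubring F) : IsLocalHom (restrictHom K V) where
  map_nonunit a ha := by
    have h1 : V.valuation (algebraMap K F (a : K)) = 1 := (V.valuation_eq_one_iff _).1 ha
    have h0 : (a : K) ≠ 0 := by
      intro h
      simp [h] at h1
    have h2 : (a : K)⁻¹ ∈ restrict K V := by
      rw [ValuationSubring.mem_comap, ← V.valuation_le_one_iff, map_inv₀, map_inv₀, h1, inv_one]
    exact IsUnit.of_mul_eq_one ⟨(a : K)⁻¹, h2⟩ (Subtype.ext (mul_inv_cancel₀ h0))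

/-- The residue field `KP`, as a subfield of the residue field `FP`. -/
noncomputable def residueSubfield (K : Type u) {F : Type u} [Field K] [Field F] [Algebra K F]
    (V : ValuationSubring F) : Subfield (IsLocalRing.ResidueField V) :=
  (IsLocalRing.ResidueField.map (restrictHom K V)).fieldRange

/-- Condition (T) for the tuple `(x, y)`: it is a transcendence basis of `F | K` with `F = K(x, y)`,
the residues of the `y j` are algebraically independent over `KP` and generate `FP` over `KP`,
and the value group of `F` is the direct sum of the value group of `K` and the infinite cyclic
groups generated by the values of the `x i`. -/
structure ConditionT (K : Type u) {F : Type u} [Field K] [Field F] [Algebra K F]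
    (V : ValuationSubring F) {ρ τ : ℕ} (x : Fin ρ → F) (y : Fin τ → V) : Prop where
  isTranscendenceBasis : IsTranscendenceBasis K (Sum.elim x (fun j => (y j : F)))
  adjoin_eq_top : IntermediateField.adjoin K (Set.range x ∪ Set.range (fun j => (y j : F))) = ⊤
  residue_algebraicIndependent :
    AlgebraicIndependent (residueSubfield K V) (fun j => IsLocalRing.residue V (y j))
  residue_adjoin_eq_top :
    IntermediateField.adjoin (residueSubfield K V)
      (Set.range (fun j => IsLocalRing.residue V (y j))) = ⊤
  value_generate : ∀ z : F, z ≠ 0 → ∃ (c : K) (n : Fin ρ → ℤ), c ≠ 0 ∧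
    V.valuation z = V.valuation (algebraMap K F c) * ∏ i, V.valuation (x i) ^ n i
  value_independent : ∀ (c : K) (n : Fin ρ → ℤ), c ≠ 0 →
    V.valuation (algebraMap K F c) * ∏ i, V.valuation (x i) ^ n i = 1 → n = 0

/-! ### Conditions (NC) and (V) -/

/-- The value in `F` of a polynomial over a subring `A` of `K` at `(x, y)`. -/
noncomputable def evalAt (A : Subring K) {F : Type u} [Field F] [Algebra K F]
    {ρ τ : ℕ} (x : Fin ρ → F) (y : Fin τ → F)
    (f : MvPolynomial (Fin ρ ⊕ Fin τ) A) : F :=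
  MvPolynomial.eval₂ ((algebraMap K F).comp A.subtype) (Sum.elim x y) f

/-- The choices whose existence is condition (NC) for `(R, Z)`: an iterated monoidal transform
`R'` of `R` along the restriction of the place to `K` that is regular, a regular parameter system
`t` of `R'`, and for every `ζ ∈ Z` a representation of `ζ` as a quotient of two nonzero
polynomials in `x, y` over `R'` all of whose (nonzero) coefficients are `R'`-monomials in `t`. -/
structure NCData (V : ValuationSubring F) (R : LocalSubring K) {ρ τ : ℕ}
    (x : Fin ρ → F) (y : Fin τ → F) (Z : Set F) where
  R' : LocalSubring K
  iterated : IsIteratedMonoidalTransform (restrict K V) R R'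
  regular : IsRegularLocalRing R'.toSubring
  d : ℕ
  t : Fin d → R'.toSubring
  isRegularParameterSystem : IsRegularParameterSystem t
  num : Z → MvPolynomial (Fin ρ ⊕ Fin τ) R'.toSubring
  den : Z → MvPolynomial (Fin ρ ⊕ Fin τ) R'.toSubring
  num_ne_zero : ∀ ζ, num ζ ≠ 0
  den_ne_zero : ∀ ζ, den ζ ≠ 0
  eq_div : ∀ ζ : Z, (ζ : F) = evalAt R'.toSubring x y (num ζ) / evalAt R'.toSubring x y (den ζ)
  num_coeff : ∀ ζ, ∀ c ∈ (num ζ).coeffs, IsMonomialIn (Set.range t) c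
  den_coeff : ∀ ζ, ∀ c ∈ (den ζ).coeffs, IsMonomialIn (Set.range t) c

namespace NCData

variable {V : ValuationSubring F} {R : LocalSubring K} {ρ τ : ℕ}
  {x : Fin ρ → F} {y : Fin τ → F} {Z : Set F}

/-- The (indices of the) parameters that occur in the prime factorization of at least one
coefficient of the chosen representations. -/
def occurring (D : NCData V R x y Z) : Set (Fin D.d) :=
  {i | ∃ ζ, ∃ c, (c ∈ (D.num ζ).coeffs ∨ c ∈ (D.den ζ).coeffs) ∧ D.t i ∣ c}

/-- The number `δ` of occurring parameters. -/
noncomputable def delta (D : NCData V R x y Z) : ℕ := D.occurring.ncard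

/-- Condition (V): the values of the occurring parameters are rationally independent. -/
def ConditionV (D : NCData V R x y Z) : Prop :=
  ∀ n : Fin D.d → ℤ, (∀ i, i ∉ D.occurring → n i = 0) →
    ∏ i, V.valuation (algebraMap K F (D.t i : K)) ^ n i = 1 → n = 0

end NCData

/-! ### Models -/

/-- The algebra `R'[x', y]` inside `F`. -/
def generatedSubring (R' : LocalSubring K) {m τ : ℕ} (x' : Fin m → F) (y : Fin τ → F) :
    Subring F :=
  Subring.closure ((algebraMap K F '' (R'.toSubring : Set K)) ∪ Set.range x' ∪ Set.range y)

/-- An `R`-model of `F`: an integral separated `R`-scheme of finite type, with an identification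
over `R` of its field of rational functions with `F`. -/
structure Model (R : LocalSubring K) (F : Type u) [Field F] [Algebra K F] where
  X : Scheme.{u}
  toBase : X ⟶ Spec (CommRingCat.of R.toSubring)
  [isIntegral : IsIntegral X]
  [isSeparated : IsSeparated toBase]
  [locallyOfFiniteType : LocallyOfFiniteType toBase]
  [quasiCompact : QuasiCompact toBase]
  functionFieldEquiv : X.functionField ≃+* F
  compatible : ∀ r : R.toSubring,
    functionFieldEquiv ((X.presheaf.germ ⊤ (genericPoint X) trivial).hom (toBase.appTop.hom
      ((Scheme.ΓSpecIso (CommRingCat.of R.toSubring)).inv.hom r))) = algebraMap K F (r : K)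

attribute [instance] Model.isIntegral

/-- The local ring of a point of a model, as a local subring of `F`. -/
noncomputable def Model.localRing {R : LocalSubring K} (𝒳 : Model R F) (p : 𝒳.X) :
    LocalSubring F :=
  LocalSubring.range (𝒳.functionFieldEquiv.toRingHom.comp
    (algebraMap (𝒳.X.presheaf.stalk p) 𝒳.X.functionField))

/-- The place with valuation ring `V` is centered in the point `p`: `V` dominates the local ring
of `p` (`≤` on local subrings is domination). -/
def Model.IsCenter {R : LocalSubring K} (𝒳 : Model R F) (V : ValuationSubring F) (p : 𝒳.X) :
    Prop :=
  𝒳.localRing p ≤ V.toLocalSubring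

/-- The model is isomorphic over the base to affine `n`-space. -/
def Model.IsAffineSpace {R : LocalSubring K} (𝒳 : Model R F) (n : ℕ) : Prop :=
  ∃ e : 𝒳.X ≅ AffineSpace (ULift.{u} (Fin n)) (Spec (CommRingCat.of R.toSubring)),
    e.hom ≫ (AffineSpace (ULift.{u} (Fin n)) (Spec (CommRingCat.of R.toSubring)) ↘
      Spec (CommRingCat.of R.toSubring)) = 𝒳.toBase

end Valued

end Uniformization

/-!
The place is made explicit by its value group. Put `S = R'`, with the regular parameters `t` of
condition (NC), and invert the `x i` of negative value. Since the residues of `y` are algebraically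
independent over `KP`, the local ring of `S[x, y]` at the center of the place is regular with
regular parameters `t` and `x` (`hasRegularParameters_polySubring`). By conditions (T) and (V) the
values of the family `z` consisting of the `x i` and the occurring `t k` are rationally independent
(`exists_initial_family`).

Every term of one of the polynomials `f_ζ`, `g_ζ` is a unit of `S` times an element of the group
generated by `z` times a monomial in `y`. Perron's algorithm replaces `z i` by `z i / z j` whenever
this quotient has positive value, and after finitely many such steps the finitely many integral
quotients of these group elements are monomials in the new family `z`, with exponents in `ℕ`
(`exists_perronSteps`). Each step blows up the local ring of `S[z, y]` and preserves regularity
and the property that `z`, together with the remaining `t k`, is a regular parameter system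
(`HasRegularParameters.blowup`); the height estimate behind it (`card_le_height_of_blowup`) rests
on regular local rings being domains. As the values of the `x i` are independent modulo the value
group of `K` and the residues of the `y j` are algebraically independent, the value of a polynomial
at `(x, y)` is attained by one of its terms (`exists_valuation_aeval_eq`), so `f_ζ(x, y)` is the
group element of that term times a unit of the local ring (`exists_evalAt_eq_mul`). Hence every
integral quotient `f_ζ(x, y) / g_ζ(x, y)` is a monomial in `z` (`exists_monomialization`).

For the model, an iterated monoidal transform of `R` is a local ring of a finitely generated
`R`-algebra `R[s] ⊆ K`, whose dimension is at most `dim R` because `R` is Noetherian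
(`exists_finite_of_isIteratedMonoidalTransform`, `ringKrullDim_closure_union_le`). The spectrum of
`R[s, z, y]` is the model (`localizationAtCenter_polySubring_eq`, `affineModel`). If `R = K`, no
monoidal transform exists and no `t k` is left; the `z i` and `y j` are then algebraically
independent over `K`, and the model is affine space.

Mathlib valuations are multiplicative: positive value means `v a < 1`, and value zero `v a = 1`.
-/

namespace Uniformization

open IsLocalRing

/-! ### Regular local rings are domains -/

theorem ringKrullDim_le_card_of_span_range_eq {A : Type*} [CommRing A] [IsLocalRing A]
    [IsNoetherianRing A] {J : Type*} [Fintype J] (a : J → A)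
    (h : Ideal.span (Set.range a) = maximalIdeal A) :
    ringKrullDim A ≤ Fintype.card J := by
  refine (ringKrullDim_le_spanFinrank_maximalIdeal A).trans ?_
  rw [← h]
  have h1 := Submodule.spanFinrank_span_le_ncard_of_finite (R := A) (Set.finite_range a)
  have h2 : (Set.range a).ncard ≤ Fintype.card J := by
    rw [← Set.image_univ, ← Nat.card_eq_fintype_card, ← Set.ncard_univ]
    exact Set.ncard_image_le
  exact_mod_cast h1.trans h2

/-- Induction on the number of generators: by prime avoidance some `x` in the maximal ideal but not
in its square avoids all minimal primes; the quotient by `x` is a domain by induction, so `(x)` is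
prime, and a minimal prime inside `(x)` vanishes by Nakayama's lemma. -/
theorem isDomain_of_span_range_fin {n : ℕ} : ∀ {A : Type u} [CommRing A] [IsLocalRing A]
    [IsNoetherianRing A] (a : Fin n → A), Ideal.span (Set.range a) = maximalIdeal A →
    (n : WithBot ℕ∞) ≤ ringKrullDim A → IsDomain A := by
  induction n with
  | zero =>
    intro A _ _ _ a ha _
    have : maximalIdeal A = ⊥ := by rw [← ha]; simp
    exact ((isField_iff_maximalIdeal_eq).2 this).isDomain
  | succ n ih =>
    intro A _ _ _ a ha hd
    set m := maximalIdeal A with hm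
    have hmin : ∀ p ∈ minimalPrimes A, ¬ m ≤ p := by
      intro p hp hle
      have hpp : p.IsPrime := hp.1.1
      have : p = m := le_antisymm (le_maximalIdeal hpp.ne_top) hle
      have h0 : p.height = 0 := Ideal.height_eq_zero_iff.2 hp
      rw [this] at h0
      rw [← maximalIdeal_height_eq_ringKrullDim, ← hm, h0] at hd
      have : ((n + 1 : ℕ) : ℕ∞) ≤ 0 := by exact_mod_cast hd
      simp at this
    have hsq : ¬ m ≤ m ^ 2 := by
      intro hle
      have h1 : m ≤ m • m := by rwa [smul_eq_mul, ← pow_two]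
      have h2 : m = ⊥ := Submodule.eq_bot_of_le_smul_of_le_jacobson_bot m m
        (IsNoetherian.noetherian m) h1 (maximalIdeal_le_jacobson _)
      obtain ⟨p, hp⟩ := Ideal.nonempty_minimalPrimes (I := (⊥ : Ideal A)) bot_ne_top
      exact hmin p hp (h2 ▸ bot_le)
    -- prime avoidance
    obtain ⟨x, hxm, hx2, hxp⟩ : ∃ x ∈ m, x ∉ m ^ 2 ∧ ∀ p ∈ minimalPrimes A, x ∉ p := by
      by_contra! hcon
      have hfin := minimalPrimes.finite_of_isNoetherianRing A
      have := (Ideal.subset_union_prime (s := insert (m ^ 2) hfin.toFinset) (f := id)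
        (m ^ 2) (m ^ 2) (by
          intro i hi h1 _
          rcases Finset.mem_insert.1 hi with h | h
          · exact absurd h h1
          · exact (hfin.mem_toFinset.1 h).1.1) (I := m)).1 (by
          intro x hx
          by_cases h2 : x ∈ m ^ 2
          · exact Set.mem_biUnion (x := m ^ 2) (by simp) h2
          · obtain ⟨p, hp, hxp⟩ := hcon x hx h2
            exact Set.mem_biUnion (x := p) (by simp [hp]) hxp)
      obtain ⟨i, hi, hle⟩ := this
      rcases Finset.mem_insert.1 hi with h | h
      · exact hsq (h ▸ hle)
      · exact hmin i (hfin.mem_toFinset.1 h) hle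
    -- exchange `x` for one of the generators
    obtain ⟨c, hc⟩ : ∃ c : Fin (n + 1) → A, ∑ i, c i * a i = x := by
      have hxs : x ∈ Ideal.span (Set.range a) := ha ▸ hxm
      simpa [smul_eq_mul] using (Ideal.mem_span_range_iff_exists_fun).1 hxs
    have ham : ∀ i, a i ∈ m := fun i => ha ▸ Ideal.subset_span ⟨i, rfl⟩
    obtain ⟨i, hi⟩ : ∃ i, IsUnit (c i) := by
      by_contra! hcon
      apply hx2
      rw [← hc]
      refine Ideal.sum_mem _ fun i _ => ?_
      rw [pow_two]
      exact Ideal.mul_mem_mul ((mem_maximalIdeal _).2 (hcon i)) (ham i)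
    obtain ⟨u, hu⟩ := hi
    have hnt : Nontrivial (A ⧸ Ideal.span {x}) :=
      Ideal.Quotient.nontrivial_iff.2 (ne_top_of_le_ne_top (maximalIdeal.isMaximal A).ne_top
        ((Ideal.span_singleton_le_iff_mem _).2 hxm))
    have hsurj := Ideal.Quotient.mk_surjective (I := Ideal.span {x})
    have : IsLocalRing (A ⧸ Ideal.span {x}) := .of_surjective' _ hsurj
    have hmax : maximalIdeal (A ⧸ Ideal.span {x}) = m.map (Ideal.Quotient.mk (Ideal.span {x})) :=
      (map_maximalIdeal_of_surjective _ hsurj).symm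
    have hdom : IsDomain (A ⧸ Ideal.span {x}) := by
      refine ih (fun k => Ideal.Quotient.mk _ (a (i.succAbove k))) ?_ ?_
      · rw [hmax, ← ha, Ideal.map_span]
        refine le_antisymm (Ideal.span_mono ?_) (Ideal.span_le.2 ?_)
        · rintro _ ⟨k, rfl⟩
          exact ⟨_, ⟨_, rfl⟩, rfl⟩
        · rintro _ ⟨_, ⟨k, rfl⟩, rfl⟩
          rcases Fin.eq_self_or_eq_succAbove i k with rfl | ⟨l, rfl⟩
          · have h1 : (Ideal.Quotient.mk (Ideal.span {x})) (c k * a k) =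
                - ∑ l, Ideal.Quotient.mk (Ideal.span {x})
                  (c (k.succAbove l) * a (k.succAbove l)) := by
              rw [eq_neg_iff_add_eq_zero, ← map_sum, ← map_add, ← Fin.sum_univ_succAbove
                (fun l => c l * a l), hc]
              exact Ideal.Quotient.eq_zero_iff_mem.2 (Ideal.mem_span_singleton_self x)
            have h2 : (Ideal.Quotient.mk (Ideal.span {x})) (a k) =
                Ideal.Quotient.mk _ (↑u⁻¹ : A) * Ideal.Quotient.mk _ (c k * a k) := by
              rw [← map_mul, ← hu, ← mul_assoc, Units.inv_mul, one_mul]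
            rw [SetLike.mem_coe, h2, h1]
            refine Ideal.mul_mem_left _ _ (neg_mem (Ideal.sum_mem _ fun l _ => ?_))
            rw [map_mul]
            exact Ideal.mul_mem_left _ _ (Ideal.subset_span ⟨l, rfl⟩)
          · exact Ideal.subset_span ⟨l, rfl⟩
      · have h1 := Ideal.height_le_ringKrullDim_quotient_add_one (p := m) hxm
        rw [maximalIdeal_height_eq_ringKrullDim] at h1
        have h2 := hd.trans h1
        rw [Nat.cast_succ] at h2
        exact ENat.WithBot.add_le_add_one_right_iff.1 h2
    -- a minimal prime inside `(x)` vanishes by Nakayama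
    have hxprime : (Ideal.span {x}).IsPrime := (Ideal.Quotient.isDomain_iff_prime _).1 hdom
    obtain ⟨p, hp, hpx⟩ := Ideal.exists_minimalPrimes_le (I := (⊥ : Ideal A))
      (J := Ideal.span {x}) bot_le
    have hpp : p.IsPrime := hp.1.1
    have hple : p ≤ m • p := by
      intro y hy
      obtain ⟨b, rfl⟩ := Ideal.mem_span_singleton.1 (hpx hy)
      rw [smul_eq_mul]
      exact Ideal.mul_mem_mul hxm ((hpp.mem_or_mem hy).resolve_left (hxp p hp))
    have hp0 : p = ⊥ := Submodule.eq_bot_of_le_smul_of_le_jacobson_bot m p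
      (IsNoetherian.noetherian p) hple (maximalIdeal_le_jacobson _)
    subst hp0
    exact IsDomain.of_bot_isPrime A

/-- A Noetherian local ring whose maximal ideal is generated by `dim` many elements is a domain. -/
theorem isDomain_of_span_range_eq {A : Type u} [CommRing A] [IsLocalRing A]
    [IsNoetherianRing A] {J : Type*} [Fintype J] (a : J → A)
    (ha : Ideal.span (Set.range a) = maximalIdeal A)
    (hd : (Fintype.card J : WithBot ℕ∞) ≤ ringKrullDim A) : IsDomain A :=
  isDomain_of_span_range_fin (a ∘ (Fintype.equivFin J).symm)
    (by rw [(Fintype.equivFin J).symm.surjective.range_comp, ha]) hd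

/-! ### Heights in polynomial rings and under blowing up -/

section Height

variable {S : Type*} [CommRing S] [IsLocalRing S]

/-- Reduction of the coefficients modulo the maximal ideal and of the variables in `s` to zero. -/
noncomputable def reduceVars {σ : Type*} [DecidableEq σ] (s : Finset σ) :
    MvPolynomial σ S →+* MvPolynomial σ (ResidueField S) :=
  MvPolynomial.eval₂Hom (MvPolynomial.C.comp (residue S))
    (fun i => if i ∈ s then 0 else MvPolynomial.X i)

/-- The kernel of `reduceVars s` is generated by the maximal ideal of `S` and the variables in
`s`. -/
theorem ker_reduceVars_le {σ : Type*} [DecidableEq σ] (s : Finset σ)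
    (Q : Ideal (MvPolynomial σ S)) (hC : ∀ c ∈ maximalIdeal S, MvPolynomial.C c ∈ Q)
    (hX : ∀ i ∈ s, MvPolynomial.X i ∈ Q) : RingHom.ker (reduceVars (S := S) s) ≤ Q := by
  -- the quotient map factors through the reduction
  let l : ResidueField S →+* MvPolynomial σ S ⧸ Q :=
    Ideal.Quotient.lift (maximalIdeal S) ((Ideal.Quotient.mk Q).comp MvPolynomial.C)
      (fun c hc => Ideal.Quotient.eq_zero_iff_mem.2 (hC c hc))
  let θ : MvPolynomial σ (ResidueField S) →+* MvPolynomial σ S ⧸ Q :=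
    MvPolynomial.eval₂Hom l (fun i => Ideal.Quotient.mk Q (MvPolynomial.X i))
  have hθ : θ.comp (reduceVars s) = Ideal.Quotient.mk Q := by
    apply MvPolynomial.ringHom_ext
    · intro c
      simp only [θ, reduceVars, RingHom.comp_apply, MvPolynomial.coe_eval₂Hom,
        MvPolynomial.eval₂_C]
      rfl
    · intro i
      by_cases hi : i ∈ s
      · simp [θ, reduceVars, hi, Ideal.Quotient.eq_zero_iff_mem.2 (hX i hi)]
      · simp [θ, reduceVars, hi]
  intro f hf
  rw [← Ideal.Quotient.eq_zero_iff_mem, ← hθ, RingHom.comp_apply, RingHom.mem_ker.1 hf, map_zero]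

/-- A prime of `S[X]` which contains the maximal ideal of `S` and the variables in `s` has height at
least `dim S + |s|`: killing the variables one by one gives a chain of primes above the extension
of the maximal ideal. -/
theorem ringKrullDim_add_card_le_height [IsNoetherianRing S] {σ : Type*} [Finite σ]
    (s : Finset σ) (Q : Ideal (MvPolynomial σ S)) [Q.IsPrime]
    (hC : ∀ c ∈ maximalIdeal S, MvPolynomial.C c ∈ Q) (hX : ∀ i ∈ s, MvPolynomial.X i ∈ Q) :
    ringKrullDim S + s.card ≤ Q.height := by
  classical
  have hprime : ∀ s : Finset σ, (RingHom.ker (reduceVars (S := S) s)).IsPrime :=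
    fun s => RingHom.ker_isPrime _
  have key : ∀ s : Finset σ, ringKrullDim S + s.card ≤
      (RingHom.ker (reduceVars (S := S) s)).height := by
    intro s
    induction s using Finset.induction_on with
    | empty =>
      have hC' : ∀ c ∈ maximalIdeal S,
          (MvPolynomial.C c : MvPolynomial σ S) ∈ RingHom.ker (reduceVars (S := S) ∅) := by
        intro c hc
        rw [RingHom.mem_ker]
        simp [reduceVars, hc]
      have : (RingHom.ker (reduceVars (S := S) (∅ : Finset σ))).LiesOver (maximalIdeal S) := by
        constructor
        exact Ideal.IsMaximal.eq_of_le inferInstance Ideal.IsPrime.ne_top' fun c hc => hC' c hc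
      rw [Ideal.height_eq_height_add_of_liesOver_of_hasGoingDown (maximalIdeal S),
        ← maximalIdeal_height_eq_ringKrullDim]
      simp only [Finset.card_empty, Nat.cast_zero, add_zero]
      exact_mod_cast le_self_add
    | insert i s hi ih =>
      have hlt : RingHom.ker (reduceVars (S := S) s) <
          RingHom.ker (reduceVars (S := S) (insert i s)) := by
        refine lt_of_le_of_ne (ker_reduceVars_le _ _ ?_ ?_) fun h => ?_
        · intro c hc
          rw [RingHom.mem_ker]
          simp [reduceVars, hc]
        · intro j hj
          rw [RingHom.mem_ker]
          simp [reduceVars, hj]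
        · have h1 : (MvPolynomial.X i : MvPolynomial σ S) ∈
              RingHom.ker (reduceVars (S := S) (insert i s)) := by
            rw [RingHom.mem_ker]
            simp [reduceVars]
          rw [← h, RingHom.mem_ker] at h1
          simp [reduceVars, hi] at h1
      have h1 := Ideal.height_add_one_le_of_lt_of_isPrime hlt
      rw [Finset.card_insert_of_notMem hi, Nat.cast_succ, ← add_assoc]
      refine (add_le_add_left ih 1).trans ?_
      exact_mod_cast h1
  refine (key s).trans ?_
  exact_mod_cast Ideal.height_mono (ker_reduceVars_le s Q hC hX)

/-- Let `J` be an ideal of `S[X_α, Y_β]` containing the maximal ideal of `S` and all `X_a`. A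
polynomial lies in `J` as soon as setting `X = 0` and reducing its coefficients kills it. -/
theorem mem_of_reduce_eq_zero {α β : Type*} (J : Ideal (MvPolynomial (α ⊕ β) S))
    (hC : ∀ c ∈ maximalIdeal S, MvPolynomial.C c ∈ J)
    (hX : ∀ a, MvPolynomial.X (Sum.inl a) ∈ J) (f : MvPolynomial (α ⊕ β) S)
    (hf : MvPolynomial.eval₂ (MvPolynomial.C.comp (residue S))
      (Sum.elim (fun _ => 0) (fun b => MvPolynomial.X b)) f =
        (0 : MvPolynomial β (ResidueField S))) : f ∈ J := by
  let l : ResidueField S →+* MvPolynomial (α ⊕ β) S ⧸ J :=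
    Ideal.Quotient.lift (maximalIdeal S) ((Ideal.Quotient.mk J).comp MvPolynomial.C)
      (fun c hc => Ideal.Quotient.eq_zero_iff_mem.2 (hC c hc))
  let θ : MvPolynomial β (ResidueField S) →+* MvPolynomial (α ⊕ β) S ⧸ J :=
    MvPolynomial.eval₂Hom l (fun i => Ideal.Quotient.mk J (MvPolynomial.X (Sum.inr i)))
  have hθ : θ.comp (MvPolynomial.eval₂Hom (MvPolynomial.C.comp (residue S))
      (Sum.elim (fun _ => 0) (fun b => MvPolynomial.X b))) = Ideal.Quotient.mk J := by
    apply MvPolynomial.ringHom_ext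
    · intro c
      simp only [θ, RingHom.comp_apply, MvPolynomial.coe_eval₂Hom, MvPolynomial.eval₂_C]
      rfl
    · rintro (i | i)
      · simp [θ, Ideal.Quotient.eq_zero_iff_mem.2 (hX i)]
      · simp [θ]
  rw [← Ideal.Quotient.eq_zero_iff_mem, ← hθ, RingHom.comp_apply]
  exact (congrArg θ hf).trans (map_zero θ)

end Height

section BlowUp

/-- Cutting the localization of `P` at `Q` by an element `g` of `Q` lowers the dimension by at most
one; the resulting local ring `C` is described through the map `χ : P → C`. -/
theorem exists_localization_quotient {P : Type u} [CommRing P] [IsNoetherianRing P] (Q : Ideal P)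
    [Q.IsPrime] {g : P} (hg : g ∈ Q) :
    ∃ (C : Type u) (_ : CommRing C) (_ : IsLocalRing C) (_ : IsNoetherianRing C) (χ : P →+* C),
      χ g = 0 ∧ maximalIdeal C = Q.map χ ∧ (Q.height : WithBot ℕ∞) ≤ ringKrullDim C + 1 ∧
      (∀ s, s ∉ Q → IsUnit (χ s)) ∧ ∀ c, ∃ f s, s ∉ Q ∧ χ s * c = χ f := by
  have hN : IsNoetherianRing (Localization.AtPrime Q) :=
    IsLocalization.isNoetherianRing Q.primeCompl _ inferInstance
  let g' : Localization.AtPrime Q := algebraMap P _ g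
  have hgm : g' ∈ maximalIdeal (Localization.AtPrime Q) := by
    rw [← Localization.AtPrime.map_eq_maximalIdeal]
    exact Ideal.mem_map_of_mem _ hg
  let I : Ideal (Localization.AtPrime Q) := Ideal.span {g'}
  have hπ : Function.Surjective (Ideal.Quotient.mk I) := Ideal.Quotient.mk_surjective
  have hnt : Nontrivial (Localization.AtPrime Q ⧸ I) :=
    Ideal.Quotient.nontrivial_iff.2 (ne_top_of_le_ne_top (maximalIdeal.isMaximal _).ne_top
      ((Ideal.span_singleton_le_iff_mem _).2 hgm))
  have hloc : IsLocalRing (Localization.AtPrime Q ⧸ I) := .of_surjective' _ hπ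
  refine ⟨Localization.AtPrime Q ⧸ I, inferInstance, hloc, inferInstance,
    (Ideal.Quotient.mk I).comp (algebraMap P _), ?_, ?_, ?_, ?_, ?_⟩
  · exact Ideal.Quotient.eq_zero_iff_mem.2 (Ideal.mem_span_singleton_self g')
  · rw [← Ideal.map_map, Localization.AtPrime.map_eq_maximalIdeal]
    exact (map_maximalIdeal_of_surjective _ hπ).symm
  · have h1 := Ideal.height_le_ringKrullDim_quotient_add_one
      (p := maximalIdeal (Localization.AtPrime Q)) hgm
    rwa [maximalIdeal_height_eq_ringKrullDim,
      IsLocalization.AtPrime.ringKrullDim_eq_height Q] at h1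
  · intro s hs
    exact (IsLocalization.map_units (M := Q.primeCompl) (Localization.AtPrime Q) ⟨s, hs⟩).map
      (Ideal.Quotient.mk I)
  · intro c
    obtain ⟨b, rfl⟩ := hπ c
    obtain ⟨f, s, rfl⟩ := IsLocalization.exists_mk'_eq Q.primeCompl b
    refine ⟨f, s, s.2, ?_⟩
    rw [RingHom.comp_apply, RingHom.comp_apply, ← map_mul, mul_comm, IsLocalization.mk'_spec]

open Polynomial in
/-- Let the maximal ideal of the local ring `A` be generated by `dim A` elements `a k`, and let
`ψ : A[X] → D` be a surjection whose kernel is that of `X ↦ w`, where `w` is the quotient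
`a i / a j` in some field. A prime of `D` containing the images of `X` and of the maximal ideal
has height at least `dim A`. -/
theorem card_le_height_of_blowup {A : Type u} [CommRing A] [IsLocalRing A] [IsNoetherianRing A]
    {J : Type*} [Fintype J] [DecidableEq J] (a : J → A)
    (ha : Ideal.span (Set.range a) = maximalIdeal A)
    (hd : (Fintype.card J : WithBot ℕ∞) ≤ ringKrullDim A) {i j : J} (hij : i ≠ j)
    {F : Type*} [Field F] (e : A →+* F) (he : Function.Injective e) (w : F)
    (hw : w * e (a j) = e (a i)) {D : Type u} [CommRing D] (ψ : A[X] →+* D)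
    (hψ : Function.Surjective ψ) (hker : ∀ f, ψ f = 0 → f.eval₂ e w = 0)
    (q : Ideal D) [q.IsPrime] (hqX : ψ X ∈ q) (hqC : ∀ c ∈ maximalIdeal A, ψ (C c) ∈ q) :
    (Fintype.card J : ℕ∞) ≤ q.height := by
  have ham : ∀ k, a k ∈ maximalIdeal A := fun k => ha ▸ Ideal.subset_span ⟨k, rfl⟩
  set Q : Ideal A[X] := q.comap ψ with hQ
  have hQC : ∀ c ∈ Q.comap C, c ∈ maximalIdeal A := fun c hc =>
    le_maximalIdeal (Ideal.IsPrime.ne_top' (I := Q.comap C)) hc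
  have hmQ : (maximalIdeal A).map C ≤ Q := Ideal.map_le_iff_le_comap.2 fun c hc => hqC c hc
  -- the maximal ideal is generated by `C (a k)` and `X`
  have hQle : Q ≤ Ideal.span (Set.range fun k => C (a k)) ⊔ Ideal.span {X} := by
    intro f hf
    rw [← f.divX_mul_X_add]
    refine add_mem (Ideal.mem_sup_right (Ideal.mul_mem_left _ _
      (Ideal.mem_span_singleton_self _))) (Ideal.mem_sup_left ?_)
    have h0 : f.coeff 0 ∈ maximalIdeal A := by
      apply hQC
      have : C (f.coeff 0) = f - f.divX * X := by
        rw [eq_sub_iff_add_eq', f.divX_mul_X_add]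
      rw [Ideal.mem_comap, this]
      exact sub_mem hf (Ideal.mul_mem_left _ _ hqX)
    rw [← ha] at h0
    have := Ideal.mem_map_of_mem C h0
    rwa [Ideal.map_span, ← Set.range_comp] at this
  -- `Q` has height at least `dim A + 1`, so cutting the local ring at `Q` by the element
  -- `a j * X - a i` leaves a local ring `T` of dimension at least `dim A`, hence a regular one
  have hlt : (maximalIdeal A).map C < Q := by
    refine lt_of_le_of_ne hmQ fun h => ?_
    have : (X : A[X]) ∈ (maximalIdeal A).map C := h ▸ hqX
    rw [Ideal.mem_map_C_iff] at this
    have h1 := this 1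
    simp at h1
  have hpm : ((maximalIdeal A).map C : Ideal A[X]).IsPrime := Ideal.isPrime_map_C_of_isPrime
  have hht : (Fintype.card J : WithBot ℕ∞) + 1 ≤ Q.height := by
    have h1 := Ideal.height_add_one_le_of_lt_of_isPrime hlt
    rw [Polynomial.height_map_C] at h1
    refine (add_le_add_left hd 1).trans ?_
    rw [← maximalIdeal_height_eq_ringKrullDim]
    exact_mod_cast h1
  have hgQ : C (a j) * X - C (a i) ∈ Q :=
    sub_mem (Ideal.mul_mem_left _ _ hqX) (hqC _ (ham i))
  obtain ⟨T, _, _, _, χ, hχg, hmaxQ, hdimT, hχu, hχs⟩ := exists_localization_quotient Q hgQ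
  have hdim : (Fintype.card J : WithBot ℕ∞) ≤ ringKrullDim T :=
    ENat.WithBot.add_le_add_one_right_iff.1 (hht.trans hdimT)
  have hχ : χ (C (a j)) * χ X = χ (C (a i)) := by
    rwa [← map_mul, ← sub_eq_zero, ← map_sub]
  have hχm : ∀ f ∈ Q, χ f ∈ maximalIdeal T := fun f hf =>
    hmaxQ ▸ Ideal.mem_map_of_mem _ hf
  have hmax : Ideal.span (Set.range (Function.update (fun k => χ (C (a k))) i (χ X))) =
      maximalIdeal T := by
    apply le_antisymm
    · rw [Ideal.span_le]
      rintro _ ⟨k, rfl⟩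
      by_cases hk : k = i
      · subst hk
        simpa using hχm _ hqX
      · simpa [hk] using hχm _ (hqC _ (ham k))
    · rw [hmaxQ]
      refine (Ideal.map_mono hQle).trans ?_
      have hXm : χ X ∈ Ideal.span (Set.range (Function.update (fun k => χ (C (a k))) i (χ X))) :=
        Ideal.subset_span ⟨i, by simp⟩
      rw [Ideal.map_sup, Ideal.map_span, Ideal.map_span, sup_le_iff, Ideal.span_le, Ideal.span_le]
      constructor
      · rintro _ ⟨_, ⟨k, rfl⟩, rfl⟩
        by_cases hk : k = i
        · subst hk
          rw [SetLike.mem_coe, ← hχ]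
          exact Ideal.mul_mem_left _ _ hXm
        · exact Ideal.subset_span ⟨k, by simp [hk]⟩
      · rintro _ ⟨_, rfl, rfl⟩
        exact hXm
  have hdom : IsDomain T := isDomain_of_span_range_eq _ hmax hdim
  -- otherwise the other parameters would generate the maximal ideal of `T`
  have haj : χ (C (a j)) ≠ 0 := by
    intro h0
    have h1 := ringKrullDim_le_card_of_span_range_eq
      (fun k : {k // k ≠ j} => Function.update (fun k => χ (C (a k))) i (χ X) k) (by
        rw [← hmax]
        refine le_antisymm (Ideal.span_mono ?_) (Ideal.span_le.2 ?_)
        · rintro _ ⟨k, rfl⟩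
          exact ⟨k, rfl⟩
        · rintro _ ⟨k, rfl⟩
          by_cases hk : k = j
          · subst hk
            simp [Ne.symm hij, h0]
          · exact Ideal.subset_span ⟨⟨k, hk⟩, rfl⟩)
    have h2 : Fintype.card J ≤ Fintype.card {k // k ≠ j} := by exact_mod_cast hdim.trans h1
    have h3 : Fintype.card {k // k ≠ j} < Fintype.card J :=
      Fintype.card_subtype_lt (x := j) (by simp)
    omega
  -- a polynomial vanishing at `a i / a j` vanishes in `T` after multiplication by a power of `a j`,
  -- and `T` is a domain: hence `χ` factors through `ψ`
  have hχψ : ∀ f, ψ f = 0 → χ f = 0 := by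
    intro f hf
    have h1 := Polynomial.scaleRoots_eval₂_mul (p := f) e w (a j)
    rw [hker f hf, mul_zero, mul_comm, hw, Polynomial.eval₂_at_apply, map_eq_zero_iff e he] at h1
    have h2 := Polynomial.scaleRoots_eval₂_mul (p := f) (χ.comp C) (χ X) (a j)
    rw [RingHom.comp_apply, hχ, ← RingHom.comp_apply χ C, Polynomial.eval₂_at_apply, h1,
      map_zero] at h2
    have h3 : f.eval₂ (χ.comp C) (χ X) = χ f := by
      rw [← Polynomial.hom_eval₂, Polynomial.eval₂_C_X]
    rw [h3] at h2
    exact (mul_eq_zero.1 h2.symm).resolve_left (pow_ne_zero _ haj)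
  let θ : D →+* T :=
    ψ.liftOfSurjective hψ ⟨χ, fun f hf => hχψ f hf⟩
  have hθ : ∀ f, θ (ψ f) = χ f := fun f =>
    RingHom.liftOfRightInverse_comp_apply ψ _ _ ⟨χ, fun f hf => hχψ f hf⟩ f
  have hunit : ∀ s : q.primeCompl, IsUnit (θ s) := by
    rintro ⟨s, hs⟩
    obtain ⟨f, rfl⟩ := hψ s
    rw [hθ]
    exact hχu f hs
  let Θ : Localization.AtPrime q →+* T := IsLocalization.lift hunit
  have hΘ : Function.Surjective Θ := by
    intro c
    obtain ⟨f, s, hs, hsc⟩ := hχs c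
    refine ⟨IsLocalization.mk' _ (ψ f) (⟨ψ s, hs⟩ : q.primeCompl), ?_⟩
    rw [IsLocalization.lift_mk'_spec, hθ, hθ, hsc]
  have := hdim.trans (ringKrullDim_le_of_surjective Θ hΘ)
  rw [IsLocalization.AtPrime.ringKrullDim_eq_height q] at this
  exact_mod_cast this

end BlowUp

variable {K F : Type u} [Field K] [Field F] [Algebra K F]

/-! ### Local rings at the center of a place -/

section Center

theorem mem_centerIdeal {V : ValuationSubring F} {A : Subring F} (h : A ≤ V.toSubring) (a : A) :
    a ∈ centerIdeal V A h ↔ V.valuation (a : F) < 1 := by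
  rw [centerIdeal, Ideal.mem_comap, V.valuation_lt_one_iff]
  rfl

noncomputable instance (V : ValuationSubring F) (A : Subring F) (h : A ≤ V.toSubring) :
    Algebra A (localizationAtCenter V A h).toSubring :=
  inferInstanceAs (Algebra A (LocalSubring.ofPrime A (centerIdeal V A h)).toSubring)

instance (V : ValuationSubring F) (A : Subring F) (h : A ≤ V.toSubring) :
    IsLocalization.AtPrime (localizationAtCenter V A h).toSubring (centerIdeal V A h) :=
  inferInstanceAs (IsLocalization.AtPrime
    (LocalSubring.ofPrime A (centerIdeal V A h)).toSubring (centerIdeal V A h))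

/-- The local ring at the center consists of the fractions whose denominator has value zero, that
is, multiplicative value one. -/
theorem mem_localizationAtCenter {V : ValuationSubring F} {A : Subring F} (h : A ≤ V.toSubring)
    {z : F} : z ∈ (localizationAtCenter V A h).toSubring ↔
      ∃ a ∈ A, ∃ s ∈ A, V.valuation s = 1 ∧ z = a / s := by
  have hs : ∀ s : A, s ∉ centerIdeal V A h ↔ V.valuation (s : F) = 1 := by
    intro s
    rw [mem_centerIdeal, not_lt]
    exact ⟨fun h1 => le_antisymm (V.valuation_le_one ⟨s, h s.2⟩) h1, fun h1 => h1.ge⟩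
  constructor
  · intro hz
    obtain ⟨a, s, hz'⟩ := IsLocalization.exists_mk'_eq (centerIdeal V A h).primeCompl
      (⟨z, hz⟩ : (localizationAtCenter V A h).toSubring)
    refine ⟨a, a.2, s, s.1.2, (hs _).1 s.2, ?_⟩
    have h1 := IsLocalization.mk'_spec (localizationAtCenter V A h).toSubring a s
    rw [hz'] at h1
    have h2 : z * ((s : A) : F) = (a : F) := congrArg Subtype.val h1
    have h3 : ((s : A) : F) ≠ 0 := by
      intro h0
      have := (hs _).1 s.2
      simp [h0] at this
    rw [eq_div_iff h3, h2]
  · rintro ⟨a, ha, s, hsA, hs1, rfl⟩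
    have hs' : (⟨s, hsA⟩ : A) ∈ (centerIdeal V A h).primeCompl := (hs _).2 hs1
    have h1 := IsLocalization.mk'_spec (localizationAtCenter V A h).toSubring
      (⟨a, ha⟩ : A) ⟨_, hs'⟩
    have h2 : ((IsLocalization.mk' (localizationAtCenter V A h).toSubring (⟨a, ha⟩ : A)
      (⟨_, hs'⟩ : (centerIdeal V A h).primeCompl) : (localizationAtCenter V A h).toSubring) : F) * s
        = a := congrArg Subtype.val h1
    have h3 : s ≠ 0 := by
      rintro rfl
      simp at hs1
    rw [← h2, mul_div_cancel_right₀ _ h3]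
    exact Subtype.property _

theorem le_localizationAtCenter {V : ValuationSubring F} {A : Subring F} (h : A ≤ V.toSubring) :
    A ≤ (localizationAtCenter V A h).toSubring := fun a ha =>
  (mem_localizationAtCenter h).2 ⟨a, ha, 1, A.one_mem, map_one _, (div_one a).symm⟩

theorem inv_mem_localizationAtCenter {V : ValuationSubring F} {A : Subring F}
    (h : A ≤ V.toSubring) {z : F} (hz : z ∈ (localizationAtCenter V A h).toSubring)
    (hv : V.valuation z = 1) : z⁻¹ ∈ (localizationAtCenter V A h).toSubring := by
  obtain ⟨a, ha, s, hs, hs1, rfl⟩ := (mem_localizationAtCenter h).1 hz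
  rw [map_div₀, hs1, div_one] at hv
  exact (mem_localizationAtCenter h).2 ⟨s, hs, a, ha, hv, by rw [inv_div]⟩

/-- A local ring is dominated by the place if and only if it lies in the valuation ring and contains
the inverses of its elements of value zero. -/
theorem le_toLocalSubring_iff {V : ValuationSubring F} {A : LocalSubring F} :
    A ≤ V.toLocalSubring ↔ A.toSubring ≤ V.toSubring ∧
      ∀ z ∈ A.toSubring, V.valuation z = 1 → z⁻¹ ∈ A.toSubring := by
  constructor
  · rintro ⟨h, hl⟩
    refine ⟨h, fun z hz hv => ?_⟩
    have h1 : IsUnit (Subring.inclusion h ⟨z, hz⟩) := (V.valuation_eq_one_iff ⟨z, h hz⟩).2 hv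
    obtain ⟨u, hu⟩ := hl.map_nonunit _ h1
    have h2 : ((↑u⁻¹ : A.toSubring) : F) = z⁻¹ := by
      refine eq_inv_of_mul_eq_one_left ?_
      have : (↑u⁻¹ : A.toSubring) * ⟨z, hz⟩ = 1 := by rw [← hu, Units.inv_mul]
      exact congrArg Subtype.val this
    exact h2 ▸ Subtype.property _
  · rintro ⟨h, hi⟩
    refine ⟨h, ⟨fun z hz => ?_⟩⟩
    have hv : V.valuation (z : F) = 1 := (V.valuation_eq_one_iff ⟨z, h z.2⟩).1 hz
    have h0 : (z : F) ≠ 0 := by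
      intro h0
      simp [h0] at hv
    exact IsUnit.of_mul_eq_one ⟨_, hi z z.2 hv⟩ (Subtype.ext (mul_inv_cancel₀ h0))

theorem localizationAtCenter_le {V : ValuationSubring F} {A : Subring F} (h : A ≤ V.toSubring) :
    localizationAtCenter V A h ≤ V.toLocalSubring := by
  refine le_toLocalSubring_iff.2 ⟨fun z hz => ?_, fun z => inv_mem_localizationAtCenter h⟩
  obtain ⟨a, ha, s, hs, hs1, rfl⟩ := (mem_localizationAtCenter h).1 hz
  refine (V.valuation_le_one_iff _).1 ?_
  rw [map_div₀, hs1, div_one]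
  exact V.valuation_le_one ⟨a, h ha⟩

theorem localizationAtCenter_eq_of_le {V : ValuationSubring F} {A D : Subring F}
    (hA : A ≤ V.toSubring) (hD : D ≤ V.toSubring) (h1 : A ≤ D)
    (h2 : D ≤ (localizationAtCenter V A hA).toSubring) :
    localizationAtCenter V D hD = localizationAtCenter V A hA := by
  refine LocalSubring.toSubring_injective (le_antisymm (fun z hz => ?_) fun z hz => ?_)
  · obtain ⟨a, ha, s, hs, hs1, rfl⟩ := (mem_localizationAtCenter hD).1 hz
    rw [div_eq_mul_inv]
    exact mul_mem (h2 ha) (inv_mem_localizationAtCenter hA (h2 hs) hs1)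
  · obtain ⟨a, ha, s, hs, hs1, rfl⟩ := (mem_localizationAtCenter hA).1 hz
    exact (mem_localizationAtCenter hD).2 ⟨a, h1 ha, s, h1 hs, hs1, rfl⟩

theorem localizationAtCenter_self {V : ValuationSubring F} {A : LocalSubring F}
    (h : A ≤ V.toLocalSubring) :
    localizationAtCenter V A.toSubring (le_toLocalSubring_iff.1 h).1 = A := by
  refine LocalSubring.toSubring_injective (le_antisymm (fun z hz => ?_)
    (le_localizationAtCenter _))
  obtain ⟨a, ha, s, hs, hs1, rfl⟩ := (mem_localizationAtCenter _).1 hz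
  rw [div_eq_mul_inv]
  exact mul_mem ha ((le_toLocalSubring_iff.1 h).2 s hs hs1)

theorem mem_maximalIdeal_iff_valuation {V : ValuationSubring F} {A : LocalSubring F}
    (h : A ≤ V.toLocalSubring) (a : A.toSubring) :
    a ∈ maximalIdeal A.toSubring ↔ V.valuation (a : F) < 1 := by
  obtain ⟨h1, h2⟩ := le_toLocalSubring_iff.1 h
  obtain ⟨_, hl⟩ := h
  rw [mem_maximalIdeal, mem_nonunits_iff, ← not_le, not_iff_not]
  have h3 : IsUnit (Subring.inclusion h1 a) ↔ V.valuation (a : F) = 1 :=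
    V.valuation_eq_one_iff ⟨a, h1 a.2⟩
  constructor
  · intro hu
    exact (h3.1 (hu.map _)).ge
  · intro hu
    exact hl.map_nonunit _ (h3.2 (le_antisymm (V.valuation_le_one ⟨a, h1 a.2⟩) hu))

end Center

/-- The elements `b j` of the local ring `A` form a regular parameter system, so that `A` is
regular. -/
structure HasRegularParameters (A : LocalSubring F) {J : Type*} [Fintype J] (b : J → F) :
    Prop where
  isNoetherianRing : IsNoetherianRing A.toSubring
  ringKrullDim_eq : ringKrullDim A.toSubring = Fintype.card J
  mem : ∀ j, b j ∈ A.toSubring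
  span_eq : Ideal.span (Set.range fun j => (⟨b j, mem j⟩ : A.toSubring)) =
    maximalIdeal A.toSubring

theorem HasRegularParameters.isRegularLocalRing {A : LocalSubring F} {J : Type*} [Fintype J]
    {b : J → F} (h : HasRegularParameters A b) : IsRegularLocalRing A.toSubring := by
  have := h.isNoetherianRing
  refine .of_spanFinrank_maximalIdeal_le _ ?_
  rw [h.ringKrullDim_eq, ← h.span_eq]
  have h1 := Submodule.spanFinrank_span_le_ncard_of_finite (R := A.toSubring)
    (Set.finite_range fun j => (⟨b j, h.mem j⟩ : A.toSubring))
  have h2 : (Set.range fun j => (⟨b j, h.mem j⟩ : A.toSubring)).ncard ≤ Fintype.card J := by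
    rw [← Set.image_univ, ← Nat.card_eq_fintype_card, ← Set.ncard_univ]
    exact Set.ncard_image_le
  exact_mod_cast h1.trans h2

theorem HasRegularParameters.comp_equiv {A : LocalSubring F} {J J' : Type*} [Fintype J]
    [Fintype J'] {b : J → F} (h : HasRegularParameters A b) (e : J' ≃ J) :
    HasRegularParameters A (b ∘ e) where
  isNoetherianRing := h.isNoetherianRing
  ringKrullDim_eq := by rw [h.ringKrullDim_eq, Fintype.card_congr e]
  mem j := h.mem (e j)
  span_eq := by
    rw [← h.span_eq]
    congr 1
    exact e.surjective.range_comp (fun j => (⟨b j, h.mem j⟩ : A.toSubring))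

/-- If the center has at least as large a height as the number of its generators `b j`, these are a
regular parameter system of the local ring. -/
theorem hasRegularParameters_localizationAtCenter {V : ValuationSubring F} {G : Subring F}
    (hG : G ≤ V.toSubring) [IsNoetherianRing G] {J : Type*} [Fintype J] (b : J → G)
    (hb : centerIdeal V G hG = Ideal.span (Set.range b))
    (hht : (Fintype.card J : ℕ∞) ≤ (centerIdeal V G hG).height) :
    HasRegularParameters (localizationAtCenter V G hG) fun j => (b j : F) := by
  have hN : IsNoetherianRing (localizationAtCenter V G hG).toSubring :=
    IsLocalization.isNoetherianRing (centerIdeal V G hG).primeCompl _ inferInstance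
  have hspan : Ideal.span (Set.range fun j => (⟨b j, le_localizationAtCenter hG (b j).2⟩ :
      (localizationAtCenter V G hG).toSubring)) = maximalIdeal _ := by
    rw [← IsLocalization.AtPrime.map_eq_maximalIdeal (centerIdeal V G hG), hb, Ideal.map_span,
      ← Set.range_comp]
    rfl
  refine ⟨hN, le_antisymm (ringKrullDim_le_card_of_span_range_eq _ hspan) ?_, _, hspan⟩
  rw [IsLocalization.AtPrime.ringKrullDim_eq_height (centerIdeal V G hG)]
  exact_mod_cast hht

/-! ### Regular parameters of polynomial rings and blow-ups -/

/-- The subring `S[x, y]` of `F` generated over a subring `S` of `K` by two families. -/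
def polySubring (S : Subring K) {ι β : Type*} (x : ι → F) (y : β → F) : Subring F :=
  Subring.closure ((algebraMap K F '' (S : Set K)) ∪ Set.range x ∪ Set.range y)

section polySubring

variable {S : Subring K} {ι β : Type*} {x : ι → F} {y : β → F}

theorem algebraMap_mem_polySubring {c : K} (hc : c ∈ S) : algebraMap K F c ∈ polySubring S x y :=
  Subring.subset_closure (.inl (.inl ⟨c, hc, rfl⟩))

theorem left_mem_polySubring (i : ι) : x i ∈ polySubring S x y :=
  Subring.subset_closure (.inl (.inr ⟨i, rfl⟩))

theorem right_mem_polySubring (j : β) : y j ∈ polySubring S x y :=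
  Subring.subset_closure (.inr ⟨j, rfl⟩)

theorem polySubring_le {D : Subring F} (hS : ∀ c ∈ S, algebraMap K F c ∈ D) (hx : ∀ i, x i ∈ D)
    (hy : ∀ j, y j ∈ D) : polySubring S x y ≤ D := by
  rw [polySubring, Subring.closure_le]
  rintro _ ((⟨c, hc, rfl⟩ | ⟨i, rfl⟩) | ⟨j, rfl⟩)
  exacts [hS c hc, hx i, hy j]

theorem polySubring_eq_range :
    polySubring S x y = (MvPolynomial.eval₂Hom ((algebraMap K F).comp S.subtype)
      (Sum.elim x y)).range := by
  refine le_antisymm (polySubring_le (fun c hc => ⟨MvPolynomial.C ⟨c, hc⟩, by simp⟩)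
    (fun i => ⟨MvPolynomial.X (Sum.inl i), by simp⟩)
    (fun j => ⟨MvPolynomial.X (Sum.inr j), by simp⟩)) ?_
  rintro _ ⟨f, rfl⟩
  induction f using MvPolynomial.induction_on with
  | C c => simpa using algebraMap_mem_polySubring c.2
  | add f g hf hg => rw [map_add]; exact add_mem hf hg
  | mul_X f n hf =>
    rw [map_mul]
    refine mul_mem hf ?_
    rcases n with i | j
    · simpa using left_mem_polySubring i
    · simpa using right_mem_polySubring j

instance [IsNoetherianRing S] [Finite ι] [Finite β] : IsNoetherianRing (polySubring S x y) := by
  rw [polySubring_eq_range]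
  exact isNoetherianRing_range _

end polySubring

/-- Adjoining algebraically independent elements gives a polynomial ring. -/
theorem exists_mvPolynomial_equiv_polySubring (S : Subring K) {ι β : Type*} {x : ι → F} {y : β → F}
    (h : AlgebraicIndependent K (Sum.elim x y)) :
    ∃ e : MvPolynomial (ι ⊕ β) S ≃+* polySubring S x y, ∀ f,
      (e f : F) = MvPolynomial.eval₂Hom ((algebraMap K F).comp S.subtype) (Sum.elim x y) f := by
  let ev : MvPolynomial (ι ⊕ β) S →+* F :=
    MvPolynomial.eval₂Hom ((algebraMap K F).comp S.subtype) (Sum.elim x y)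
  have hev : polySubring S x y = ev.range := polySubring_eq_range
  have hinj : Function.Injective ev := by
    intro f g hfg
    have h1 : ∀ f, ev f = MvPolynomial.aeval (Sum.elim x y) (MvPolynomial.map S.subtype f) := by
      intro f
      rw [MvPolynomial.aeval_def, MvPolynomial.eval₂_map]
      rfl
    rw [h1, h1] at hfg
    exact MvPolynomial.map_injective _ Subtype.val_injective (h hfg)
  refine ⟨RingEquiv.ofBijective (ev.codRestrict _ fun f => hev ▸ ⟨f, rfl⟩)
    ⟨fun f g hfg => hinj (congrArg Subtype.val hfg), ?_⟩, fun f => rfl⟩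
  rintro ⟨g, hg⟩
  obtain ⟨f, rfl⟩ : g ∈ ev.range := hev ▸ hg
  exact ⟨f, rfl⟩

theorem algebraMap_mem_of_le {V : ValuationSubring F} {S : LocalSubring K}
    (hS : S ≤ (restrict K V).toLocalSubring) {c : K} (hc : c ∈ S.toSubring) :
    algebraMap K F c ∈ V :=
  (le_toLocalSubring_iff.1 hS).1 hc

theorem valuation_restrict_lt_one_iff {V : ValuationSubring F} (c : K) :
    (restrict K V).valuation c < 1 ↔ V.valuation (algebraMap K F c) < 1 := by
  have h : ∀ c : K, 1 ≤ (restrict K V).valuation c ↔ 1 ≤ V.valuation (algebraMap K F c) := by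
    intro c
    rcases eq_or_ne c 0 with rfl | hc
    · simp
    · have h1 : (restrict K V).valuation c⁻¹ ≤ 1 ↔ V.valuation (algebraMap K F c⁻¹) ≤ 1 := by
        rw [ValuationSubring.valuation_le_one_iff, ValuationSubring.valuation_le_one_iff,
          ValuationSubring.mem_comap]
      rwa [map_inv₀, map_inv₀, map_inv₀, inv_le_one₀, inv_le_one₀] at h1
      · simpa [zero_lt_iff] using hc
      · simpa [zero_lt_iff] using hc
  rw [← not_le, ← not_le, h]

/-- The map from the residue field of a local ring dominated by the place to `KP`. -/
theorem exists_residueField_hom {V : ValuationSubring F} {S : LocalSubring K}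
    (hS : S ≤ (restrict K V).toLocalSubring) :
    ∃ k : ResidueField S.toSubring →+* residueSubfield K V, ∀ c : S.toSubring,
      (k (residue _ c) : ResidueField V) =
        residue V ⟨algebraMap K F c, algebraMap_mem_of_le hS c.2⟩ := by
  have h := hS
  obtain ⟨h1, hl⟩ := h
  let i : S.toSubring →+* restrict K V := Subring.inclusion h1
  have hi : IsLocalHom i := hl
  refine ⟨(ResidueField.map (restrictHom K V)).rangeRestrictField.comp (ResidueField.map i), ?_⟩
  intro c
  rfl

/-- If `x` has positive values and the residues of `y` are algebraically independent over `KP`, the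
local ring of `S[x, y]` at the center of the place is regular; parameters of `S` together with `x`
form a regular parameter system. -/
theorem hasRegularParameters_polySubring {V : ValuationSubring F} {S : LocalSubring K}
    (hS : S ≤ (restrict K V).toLocalSubring) [IsNoetherianRing S.toSubring]
    {J ι β : Type*} [Fintype J] [Fintype ι] [Finite β] (t : J → S.toSubring)
    (ht : Ideal.span (Set.range t) = maximalIdeal S.toSubring)
    (hd : ringKrullDim S.toSubring = Fintype.card J) (x : ι → F)
    (hx : ∀ i, V.valuation (x i) < 1) (y : β → V)
    (hy : AlgebraicIndependent (residueSubfield K V) fun j => residue V (y j))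
    (hxy : AlgebraicIndependent K (Sum.elim x fun j => (y j : F)))
    (hG : polySubring S.toSubring x (fun j => (y j : F)) ≤ V.toSubring) :
    HasRegularParameters (localizationAtCenter V _ hG)
      (Sum.elim (fun j => algebraMap K F (t j)) x) := by
  classical
  set G := polySubring S.toSubring x (fun j => (y j : F)) with hGdef
  obtain ⟨e, he⟩ := exists_mvPolynomial_equiv_polySubring S.toSubring hxy
  have heC : ∀ c, (e (MvPolynomial.C c) : F) = algebraMap K F c := fun c => by
    simp [he]
  have heX : ∀ i, (e (MvPolynomial.X i) : F) = Sum.elim x (fun j => (y j : F)) i := fun c => by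
    simp [he]
  let q := centerIdeal V G hG
  let Q := q.comap e
  have hQC : ∀ c ∈ maximalIdeal S.toSubring, MvPolynomial.C c ∈ Q := by
    intro c hc
    rw [Ideal.mem_comap, mem_centerIdeal, heC, ← valuation_restrict_lt_one_iff]
    exact (mem_maximalIdeal_iff_valuation hS c).1 hc
  have hQX : ∀ i, MvPolynomial.X (Sum.inl i) ∈ Q := by
    intro i
    rw [Ideal.mem_comap, mem_centerIdeal, heX]
    exact hx i
  have hht : ((Fintype.card (J ⊕ ι) : ℕ) : ℕ∞) ≤ q.height := by
    have h1 := ringKrullDim_add_card_le_height (Finset.univ.map (Function.Embedding.inl)) Q hQC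
      (by
        intro i hi
        obtain ⟨j, _, rfl⟩ := Finset.mem_map.1 hi
        exact hQX j)
    have h2 : Q.height = q.height := e.height_comap q
    rw [h2, hd, Finset.card_map, Finset.card_univ] at h1
    rw [Fintype.card_sum]
    exact_mod_cast h1
  let b : J ⊕ ι → G := Sum.elim
    (fun j => ⟨algebraMap K F (t j), algebraMap_mem_polySubring (t j).2⟩)
    (fun i => ⟨x i, left_mem_polySubring i⟩)
  have hb : (fun j => (b j : F)) = Sum.elim (fun j => algebraMap K F (t j)) x := by
    funext j
    rcases j with j | i <;> rfl
  rw [← hb]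
  refine hasRegularParameters_localizationAtCenter hG b (le_antisymm ?_ ?_) hht
  · -- as the residues of `y` are algebraically independent over `KP`, an element of the center is
    -- killed by reduction modulo the maximal ideal of `S` and `x`, hence lies in the span
    intro g hg
    obtain ⟨f, rfl⟩ := e.surjective g
    obtain ⟨k, hk⟩ := exists_residueField_hom hS
    have hb1 : ∀ j, e (MvPolynomial.C (t j)) = b (Sum.inl j) := fun j => Subtype.ext (heC _)
    have hb2 : ∀ i, e (MvPolynomial.X (Sum.inl i)) = b (Sum.inr i) := fun i => Subtype.ext (heX _)
    refine mem_of_reduce_eq_zero ((Ideal.span (Set.range b)).comap e) ?_ ?_ f ?_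
    · intro c hc
      have h1 : maximalIdeal S.toSubring ≤
          (Ideal.span (Set.range b)).comap
            ((e : MvPolynomial (ι ⊕ β) S.toSubring →+* G).comp MvPolynomial.C) := by
        rw [← ht, Ideal.span_le]
        rintro _ ⟨j, rfl⟩
        rw [SetLike.mem_coe, Ideal.mem_comap]
        exact Ideal.subset_span ⟨_, (hb1 j).symm⟩
      exact h1 hc
    · intro i
      rw [Ideal.mem_comap, hb2]
      exact Ideal.subset_span ⟨_, rfl⟩
    · have hinj : Function.Injective (MvPolynomial.map (σ := β) k) :=
        MvPolynomial.map_injective _ k.injective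
      refine hinj (hy ?_)
      rw [map_zero, map_zero]
      let i₀ : G →+* V := Subring.inclusion hG
      have h1 : residue V (i₀ (e f)) = 0 := (residue_eq_zero_iff _).2 hg
      rw [← h1]
      let φ₁ : MvPolynomial (ι ⊕ β) S.toSubring →+* ResidueField V :=
        ((MvPolynomial.aeval fun j => residue V (y j)).toRingHom.comp (MvPolynomial.map k)).comp
          (MvPolynomial.eval₂Hom (MvPolynomial.C.comp (residue S.toSubring))
            (Sum.elim (fun _ => 0) fun b => MvPolynomial.X b))
      let φ₂ : MvPolynomial (ι ⊕ β) S.toSubring →+* ResidueField V :=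
        (residue V).comp (i₀.comp e)
      have hφ : φ₁ = φ₂ := by
        apply MvPolynomial.ringHom_ext
        · intro c
          have h2 : i₀ (e (MvPolynomial.C c)) =
            ⟨algebraMap K F c, algebraMap_mem_of_le hS c.2⟩ := Subtype.ext (heC c)
          simp only [φ₁, φ₂, RingHom.comp_apply, RingHom.coe_coe, h2, ← hk]
          simp
          rfl
        · rintro (i | j)
          · have h2 : i₀ (e (MvPolynomial.X (Sum.inl i))) ∈ maximalIdeal V := by
              have := hQX i
              exact this
            simp only [φ₁, φ₂, RingHom.comp_apply, RingHom.coe_coe,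
              (residue_eq_zero_iff _).2 h2]
            simp
          · have h2 : i₀ (e (MvPolynomial.X (Sum.inr j))) = y j := Subtype.ext (heX _)
            simp only [φ₁, φ₂, RingHom.comp_apply, RingHom.coe_coe, h2]
            simp
      exact DFunLike.congr_fun hφ f
  · rw [Ideal.span_le]
    rintro _ ⟨j | i, rfl⟩
    · have := hQC (t j) (ht ▸ Ideal.subset_span ⟨j, rfl⟩)
      rw [Ideal.mem_comap, mem_centerIdeal, heC] at this
      exact (mem_centerIdeal hG _).2 this
    · exact (mem_centerIdeal hG _).2 (hx i)

open Polynomial in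
theorem closure_union_singleton_eq_range (A : Subring F) (w : F) :
    Subring.closure ((A : Set F) ∪ {w}) = (Polynomial.eval₂RingHom A.subtype w).range := by
  refine le_antisymm ?_ ?_
  · rw [Subring.closure_le]
    rintro z (hz | rfl)
    · exact ⟨C ⟨z, hz⟩, by simp⟩
    · exact ⟨X, by simp⟩
  · rintro _ ⟨f, rfl⟩
    induction f using Polynomial.induction_on' with
    | add f g hf hg => rw [map_add]; exact add_mem hf hg
    | monomial n a =>
      simp only [Polynomial.coe_eval₂RingHom, Polynomial.eval₂_monomial]
      exact mul_mem (Subring.subset_closure (.inl a.2))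
        (pow_mem (Subring.subset_closure (.inr rfl)) n)

open Polynomial in
/-- Blowing up keeps regular parameter systems: a parameter `b i` may be replaced by the quotient
`b i / b j` when this has positive value. -/
theorem HasRegularParameters.blowup {V : ValuationSubring F} {A : LocalSubring F}
    (hA : A ≤ V.toLocalSubring) {J : Type*} [Fintype J] [DecidableEq J] {b : J → F}
    (hb : HasRegularParameters A b) {i j : J} (hij : i ≠ j) (hj : b j ≠ 0)
    (hv : V.valuation (b i / b j) < 1)
    (hD : Subring.closure ((A.toSubring : Set F) ∪ {b i / b j}) ≤ V.toSubring) :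
    HasRegularParameters (localizationAtCenter V _ hD) (Function.update b i (b i / b j)) := by
  set w := b i / b j with hw
  have hN := hb.isNoetherianRing
  let ev : A.toSubring[X] →+* F := Polynomial.eval₂RingHom A.toSubring.subtype w
  set D := Subring.closure ((A.toSubring : Set F) ∪ {w}) with hDdef
  have hAD : A.toSubring ≤ D := fun a ha => Subring.subset_closure (.inl ha)
  have hwD : w ∈ D := Subring.subset_closure (.inr rfl)
  have hev : D = ev.range := closure_union_singleton_eq_range _ _
  have hND : IsNoetherianRing D := by
    rw [hev]
    exact isNoetherianRing_range _
  let ψ : A.toSubring[X] →+* D := ev.codRestrict D fun f => hev ▸ ⟨f, rfl⟩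
  have hψ : Function.Surjective ψ := by
    rintro ⟨g, hg⟩
    obtain ⟨f, rfl⟩ : g ∈ ev.range := hev ▸ hg
    exact ⟨f, rfl⟩
  have hψC : ∀ c, (ψ (C c) : F) = c := fun c => by
    change ev _ = _
    simp [ev]
  have hψX : (ψ X : F) = w := by
    change ev _ = _
    simp [ev]
  have hqX : ψ X ∈ centerIdeal V D hD := by
    rw [mem_centerIdeal, hψX]
    exact hv
  have hqC : ∀ c ∈ maximalIdeal A.toSubring, ψ (C c) ∈ centerIdeal V D hD := by
    intro c hc
    rw [mem_centerIdeal, hψC]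
    exact (mem_maximalIdeal_iff_valuation hA c).1 hc
  have hwj : w * b j = b i := div_mul_cancel₀ _ hj
  have hht := card_le_height_of_blowup _ hb.span_eq hb.ringKrullDim_eq.ge hij A.toSubring.subtype
    Subtype.val_injective w hwj ψ hψ (fun f hf => congrArg Subtype.val hf)
    (centerIdeal V D hD) hqX hqC
  let b' : J → D := Function.update (fun j => ⟨b j, hAD (hb.mem j)⟩) i ⟨w, hwD⟩
  have hb' : (fun j => (b' j : F)) = Function.update b i w := by
    funext k
    by_cases hk : k = i
    · subst hk
      simp [b']
    · simp [b', hk]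
  have hwspan : ψ X ∈ Ideal.span (Set.range b') :=
    Ideal.subset_span ⟨i, by simp only [b', Function.update_self]; exact Subtype.ext hψX.symm⟩
  have hbspan : ∀ k, ψ (C ⟨b k, hb.mem k⟩) ∈ Ideal.span (Set.range b') := by
    intro k
    by_cases hk : k = i
    · subst hk
      have : ψ (C ⟨b k, hb.mem k⟩) = ψ (C ⟨b j, hb.mem j⟩) * ψ X := by
        apply Subtype.ext
        rw [Subring.coe_mul, hψC, hψC, hψX, mul_comm]
        exact hwj.symm
      rw [this]
      exact Ideal.mul_mem_left _ _ hwspan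
    · exact Ideal.subset_span ⟨k, Subtype.ext (by simp [b', hk, hψC])⟩
  have hcspan : ∀ c ∈ maximalIdeal A.toSubring, ψ (C c) ∈ Ideal.span (Set.range b') := by
    intro c hc
    have h1 : maximalIdeal A.toSubring ≤ (Ideal.span (Set.range b')).comap (ψ.comp C) := by
      rw [← hb.span_eq, Ideal.span_le]
      rintro _ ⟨k, rfl⟩
      exact hbspan k
    exact h1 hc
  rw [← hb']
  refine hasRegularParameters_localizationAtCenter hD b' (le_antisymm ?_ ?_) hht
  · intro g hg
    obtain ⟨f, rfl⟩ := hψ g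
    have h1 : ψ f = ψ f.divX * ψ X + ψ (C (f.coeff 0)) := by
      rw [← map_mul, ← map_add, f.divX_mul_X_add]
    have h2 : ψ (C (f.coeff 0)) ∈ centerIdeal V D hD := by
      have : ψ (C (f.coeff 0)) = ψ f - ψ f.divX * ψ X := by rw [h1]; ring
      rw [this]
      exact sub_mem hg (Ideal.mul_mem_left _ _ hqX)
    rw [mem_centerIdeal, hψC] at h2
    rw [h1]
    exact add_mem (Ideal.mul_mem_left _ _ hwspan)
      (hcspan _ ((mem_maximalIdeal_iff_valuation hA _).2 h2))
  · rw [Ideal.span_le]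
    rintro _ ⟨k, rfl⟩
    by_cases hk : k = i
    · subst hk
      simp only [b', Function.update_self]
      exact (mem_centerIdeal hD _).2 hv
    · simp only [b', Function.update_of_ne hk]
      refine (mem_centerIdeal hD _).2
        ((mem_maximalIdeal_iff_valuation hA ⟨b k, hb.mem k⟩).1 ?_)
      rw [← hb.span_eq]
      exact Ideal.subset_span ⟨k, rfl⟩

/-! ### Perron's algorithm -/

section Perron

variable {G Γ₀ ι : Type*} [CommGroup G] [LinearOrderedCommGroupWithZero Γ₀]

/-- The classes of the `z i` in `G ⧸ N` are multiplicatively independent. -/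
def IndepMod [Fintype ι] (N : Subgroup G) (z : ι → G) : Prop :=
  ∀ n : ι → ℤ, ∏ i, z i ^ n i ∈ N → n = 0

/-- An elementary step of Perron's algorithm: `z i` is replaced by the quotient `z i / z j` of
positive value (in multiplicative notation, of value less than one). -/
def PerronStep [DecidableEq ι] (v : G →* Γ₀) (z z' : ι → G) : Prop :=
  ∃ i j, i ≠ j ∧ v (z i / z j) < 1 ∧ z' = Function.update z i (z i / z j)

theorem perronStep_lt_one [DecidableEq ι] {v : G →* Γ₀} {z z' : ι → G} (hz : ∀ i, v (z i) < 1)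
    (h : PerronStep v z z') (i : ι) : v (z' i) < 1 := by
  obtain ⟨k, j, -, hv, rfl⟩ := h
  by_cases hi : i = k
  · subst hi
    simpa using hv
  · simpa [hi] using hz i

theorem perronStep_closure_le [DecidableEq ι] {v : G →* Γ₀} {z z' : ι → G} (h : PerronStep v z z') :
    Submonoid.closure (Set.range z) ≤ Submonoid.closure (Set.range z') := by
  obtain ⟨k, j, hkj, -, rfl⟩ := h
  rw [Submonoid.closure_le]
  rintro _ ⟨i, rfl⟩
  by_cases hi : i = k
  · subst hi
    rw [← div_mul_cancel (z i) (z j)]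
    exact mul_mem (Submonoid.subset_closure ⟨i, by simp⟩)
      (Submonoid.subset_closure ⟨j, by simp [hkj.symm]⟩)
  · exact Submonoid.subset_closure ⟨i, by simp [hi]⟩

theorem map_le_one_of_mem_closure {v : G →* Γ₀} {z : ι → G} (hz : ∀ i, v (z i) < 1) {α : G}
    (hα : α ∈ Submonoid.closure (Set.range z)) : v α ≤ 1 := by
  induction hα using Submonoid.closure_induction with
  | mem x hx => obtain ⟨i, rfl⟩ := hx; exact (hz i).le
  | one => rw [map_one]
  | mul x y _ _ hx hy => rw [map_mul]; exact mul_le_one' hx hy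

theorem prod_zpow_mem_closure [Fintype ι] (z : ι → G) {a : ι → ℤ} (ha : ∀ i, 0 ≤ a i) :
    ∏ i, z i ^ a i ∈ Submonoid.closure (Set.range z) := by
  refine Submonoid.prod_mem _ fun i _ => ?_
  obtain ⟨n, hn⟩ := Int.eq_ofNat_of_zero_le (ha i)
  rw [hn, zpow_natCast]
  exact pow_mem (Submonoid.subset_closure (Set.mem_range_self i)) n

variable [Fintype ι] [DecidableEq ι]

/-- When `z i` is replaced by `z i / z j`, the exponent at `j` grows by the exponent at `i`. -/
theorem prod_zpow_update (z : ι → G) (a : ι → ℤ) {i j : ι} (hij : i ≠ j) :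
    ∏ k, Function.update z i (z i / z j) k ^ Function.update a j (a j + a i) k =
      ∏ k, z k ^ a k := by
  have h : ∀ k, Function.update z i (z i / z j) k ^ Function.update a j (a j + a i) k =
      z k ^ a k * ((if k = j then z j ^ a i else 1) * (if k = i then (z j ^ a i)⁻¹ else 1)) := by
    intro k
    by_cases h1 : k = i
    · subst h1
      rw [Function.update_self, Function.update_of_ne hij, div_zpow]
      simp [hij, div_eq_mul_inv]
    · by_cases h2 : k = j
      · subst h2
        simp [h1, zpow_add]
      · simp [h1, h2]
  rw [Finset.prod_congr rfl fun k _ => h k, Finset.prod_mul_distrib, Finset.prod_mul_distrib]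
  simp

theorem IndepMod.perronStep {N : Subgroup G} {v : G →* Γ₀} {z z' : ι → G} (hz : IndepMod N z)
    (h : PerronStep v z z') : IndepMod N z' := by
  obtain ⟨i, j, hij, -, rfl⟩ := h
  intro n hn
  set a := Function.update n j (n j - n i) with ha
  have h1 : Function.update a j (a j + a i) = n := by
    funext k
    by_cases hk : k = j
    · subst hk
      simp [ha, hij]
    · simp [ha, hk]
  rw [← h1, prod_zpow_update z a hij] at hn
  rw [← h1, hz a hn]
  simp

theorem perronSteps_invariant {N : Subgroup G} {v : G →* Γ₀} {z z' : ι → G}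
    (h : Relation.ReflTransGen (PerronStep v) z z') :
    (IndepMod N z → IndepMod N z') ∧ ((∀ i, v (z i) < 1) → ∀ i, v (z' i) < 1) ∧
      Submonoid.closure (Set.range z) ≤ Submonoid.closure (Set.range z') := by
  induction h with
  | refl => exact ⟨id, id, le_rfl⟩
  | tail _ h ih =>
    exact ⟨fun hz => (ih.1 hz).perronStep h, fun hz => perronStep_lt_one (ih.2.1 hz) h,
      ih.2.2.trans (perronStep_closure_le h)⟩

theorem map_div_lt_one_or {v : G →* Γ₀} {z : ι → G} (hz : IndepMod v.ker z) {i j : ι}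
    (hij : i ≠ j) : v (z i / z j) < 1 ∨ v (z j / z i) < 1 := by
  have hmul : v (z i / z j) * v (z j / z i) = 1 := by
    rw [← map_mul]
    simp
  rcases lt_trichotomy (v (z i / z j)) 1 with h | h | h
  · exact .inl h
  · exfalso
    have h1 : ∏ k, z k ^ (Pi.single i 1 - Pi.single j 1 : ι → ℤ) k = z i / z j := by
      simp only [Pi.sub_apply, zpow_sub, Finset.prod_mul_distrib, Pi.single_apply]
      simp [div_eq_mul_inv]
    have h2 := hz _ (h1 ▸ (MonoidHom.mem_ker.2 h))
    have h3 := congrFun h2 i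
    simp [hij] at h3
  · right
    by_contra! h2
    exact absurd hmul (ne_of_gt (lt_of_lt_of_le h (le_mul_of_one_le_right' h2)))

/-- Perron's algorithm for a single element `∏ i, z i ^ a i`, by a triple induction: on the bound
`M` for the `|a i|`, on the number of `i` where it is attained, and on the number of exponents of
sign opposite to a chosen `a i₀` with `|a i₀| = M`. -/
theorem exists_perronSteps_aux {v : G →* Γ₀} (M c : ℕ) : ∀ (z : ι → G) (a : ι → ℤ),
    (∀ i, v (z i) < 1) → IndepMod v.ker z → (∀ i, (a i).natAbs ≤ M) →
    (Finset.univ.filter fun i => (a i).natAbs = M).card ≤ c → v (∏ i, z i ^ a i) < 1 →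
    ∃ z', Relation.ReflTransGen (PerronStep v) z z' ∧
      ∏ i, z i ^ a i ∈ Submonoid.closure (Set.range z') := by
  induction M generalizing c with
  | zero =>
    intro z a _ _ ha _ _
    exact ⟨z, .refl, prod_zpow_mem_closure z fun i => by have := ha i; omega⟩
  | succ M ihM =>
    induction c with
    | zero =>
      intro z a hz hi ha hc hv
      refine ihM (Fintype.card ι) z a hz hi (fun i => ?_) (Finset.card_le_univ _) hv
      have h1 : i ∉ Finset.univ.filter fun i => (a i).natAbs = M + 1 := by
        rw [Finset.card_eq_zero.1 (Nat.le_zero.1 hc)]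
        simp
      have h2 := ha i
      simp at h1
      omega
    | succ c ihc =>
      intro z a hz hi ha hc hv
      by_cases hex : ∃ i, (a i).natAbs = M + 1
      swap
      · push Not at hex
        refine ihM (Fintype.card ι) z a hz hi (fun i => ?_) (Finset.card_le_univ _) hv
        have h1 := hex i
        have h2 := ha i
        omega
      obtain ⟨i₀, h₀⟩ := hex
      -- an exponent `a j` of opposite sign permits a step replacing `a j` or `a i₀` by their sum;
      -- without such exponents all of them have the same sign, which is positive as the value is
      obtain ⟨k, hk⟩ : ∃ k, (Finset.univ.filter fun j => a j * a i₀ < 0).card ≤ k := ⟨_, le_rfl⟩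
      induction k generalizing z a with
      | zero =>
        have hns : ∀ j, 0 ≤ a j * a i₀ := by
          intro j
          have h1 : j ∉ Finset.univ.filter fun j => a j * a i₀ < 0 := by
            rw [Finset.card_eq_zero.1 (Nat.le_zero.1 hk)]
            simp
          simpa using h1
        rcases lt_or_gt_of_ne (show a i₀ ≠ 0 by omega) with hneg | hpos
        · exfalso
          have h1 : ∏ i, z i ^ (-a) i ∈ Submonoid.closure (Set.range z) :=
            prod_zpow_mem_closure z fun i => by
              have := nonpos_of_mul_nonneg_left (hns i) hneg
              simpa using this
          have h2 := map_le_one_of_mem_closure hz h1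
          have h3 : (∏ i, z i ^ a i) * ∏ i, z i ^ (-a) i = 1 := by
            simp
          have h4 := congrArg v h3
          rw [map_mul, map_one] at h4
          exact absurd h4 (ne_of_lt (lt_of_le_of_lt (mul_le_of_le_one_right' h2) hv))
        · exact ⟨z, .refl, prod_zpow_mem_closure z fun i => nonneg_of_mul_nonneg_left (hns i) hpos⟩
      | succ k ihk =>
        by_cases hex : ∃ j, a j * a i₀ < 0
        swap
        · refine ihk z a hz hi ha hc hv h₀ ?_
          push Not at hex
          rw [Finset.filter_eq_empty_iff.2 fun j _ => not_lt.2 (hex j)]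
          simp
        obtain ⟨j, hj⟩ := hex
        have hji : j ≠ i₀ := by
          rintro rfl
          exact absurd hj (not_lt.2 (mul_self_nonneg _))
        have hsum : (a i₀ + a j).natAbs ≤ M ∧ 0 ≤ (a j + a i₀) * a i₀ := by
          have h1 := ha j
          rcases mul_neg_iff.1 hj with ⟨h2, h3⟩ | ⟨h2, h3⟩
          · exact ⟨by omega, mul_nonneg_of_nonpos_of_nonpos (by omega) h3.le⟩
          · exact ⟨by omega, mul_nonneg (by omega) h3.le⟩
        rcases map_div_lt_one_or hi hji.symm with h | h
        · -- `a j` is replaced by `a j + a i₀`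
          have hstep : PerronStep v z (Function.update z i₀ (z i₀ / z j)) :=
            ⟨i₀, j, hji.symm, h, rfl⟩
          have hprod := prod_zpow_update z a hji.symm
          set z₁ := Function.update z i₀ (z i₀ / z j)
          set a₁ := Function.update a j (a j + a i₀) with ha₁
          have ha₁i : a₁ i₀ = a i₀ := by simp [ha₁, hji.symm]
          have hb : ∀ i, (a₁ i).natAbs ≤ M + 1 := by
            intro i
            by_cases h1 : i = j
            · subst h1
              simp only [ha₁, Function.update_self]
              omega
            · simpa [ha₁, h1] using ha i
          obtain ⟨z', hz', hmem⟩ := ihk z₁ a₁ (perronStep_lt_one hz hstep)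
            (hi.perronStep hstep) hb (le_trans (Finset.card_le_card fun i => by
              by_cases h1 : i = j
              · subst h1
                simp only [ha₁, Finset.mem_filter, Finset.mem_univ, true_and, Function.update_self]
                omega
              · simp [ha₁, h1]) hc) (hprod ▸ hv) (by rw [ha₁i, h₀]) (by
              rw [ha₁i]
              refine Nat.le_of_lt_succ (lt_of_lt_of_le (Finset.card_lt_card ?_) hk)
              refine Finset.ssubset_iff_subset_ne.2 ⟨fun i => ?_, fun heq => ?_⟩
              · by_cases h1 : i = j
                · subst h1
                  simp only [ha₁, Finset.mem_filter, Finset.mem_univ, true_and,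
                    Function.update_self]
                  intro h2
                  exact absurd h2 (not_lt.2 hsum.2)
                · simp [ha₁, h1]
              · have h1 : j ∈ Finset.univ.filter fun j => a j * a i₀ < 0 := by simpa using hj
                rw [← heq] at h1
                simp only [ha₁, Finset.mem_filter, Finset.mem_univ, true_and,
                  Function.update_self] at h1
                exact absurd h1 (not_lt.2 hsum.2))
          exact ⟨z', .head hstep hz', hprod ▸ hmem⟩
        · -- `a i₀` is replaced by `a i₀ + a j`
          have hstep : PerronStep v z (Function.update z j (z j / z i₀)) := ⟨j, i₀, hji, h, rfl⟩
          have hprod := prod_zpow_update z a hji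
          set z₁ := Function.update z j (z j / z i₀)
          set a₁ := Function.update a i₀ (a i₀ + a j) with ha₁
          have hb : ∀ i, (a₁ i).natAbs ≤ M + 1 := by
            intro i
            by_cases h1 : i = i₀
            · subst h1
              simp only [ha₁, Function.update_self]
              omega
            · simpa [ha₁, h1] using ha i
          obtain ⟨z', hz', hmem⟩ := ihc z₁ a₁ (perronStep_lt_one hz hstep)
            (hi.perronStep hstep) hb (by
              refine Nat.le_of_lt_succ (lt_of_lt_of_le (Finset.card_lt_card ?_) hc)
              refine Finset.ssubset_iff_subset_ne.2 ⟨fun i => ?_, fun heq => ?_⟩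
              · by_cases h1 : i = i₀
                · subst h1
                  simp only [ha₁, Finset.mem_filter, Finset.mem_univ, true_and,
                    Function.update_self]
                  omega
                · simp [ha₁, h1]
              · have h1 : i₀ ∈ Finset.univ.filter fun i => (a i).natAbs = M + 1 := by simpa using h₀
                rw [← heq] at h1
                simp only [ha₁, Finset.mem_filter, Finset.mem_univ, true_and,
                  Function.update_self] at h1
                omega) (hprod ▸ hv)
          exact ⟨z', .head hstep hz', hprod ▸ hmem⟩

/-- Perron's algorithm: finitely many elements of positive value in the group generated by a
value-independent family `z` of elements of positive value become monomials after finitely many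
elementary steps. -/
theorem exists_perronSteps {v : G →* Γ₀} {z : ι → G} (hz : ∀ i, v (z i) < 1)
    (hi : IndepMod v.ker z) {T : Set G} (hT : T.Finite)
    (hTz : ∀ α ∈ T, α ∈ Subgroup.closure (Set.range z) ∧ v α < 1) :
    ∃ z', Relation.ReflTransGen (PerronStep v) z z' ∧
      ∀ α ∈ T, α ∈ Submonoid.closure (Set.range z') := by
  induction T, hT using Set.Finite.induction_on with
  | empty => exact ⟨z, .refl, by simp⟩
  | @insert α T _ _ ih =>
    obtain ⟨z₁, h1, h2⟩ := ih fun β hβ => hTz β (.inr hβ)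
    obtain ⟨hα, hv⟩ := hTz α (.inl rfl)
    obtain ⟨hi₁, hz₁, hle⟩ := perronSteps_invariant (N := v.ker) h1
    have hα₁ : α ∈ Subgroup.closure (Set.range z₁) := by
      refine (Subgroup.closure_le _).2 ?_ hα
      rintro _ ⟨i, rfl⟩
      exact Subgroup.le_closure_toSubmonoid _ (hle (Submonoid.subset_closure ⟨i, rfl⟩))
    obtain ⟨a, rfl⟩ := Subgroup.exists_of_mem_closure_range _ _ hα₁
    obtain ⟨z₂, h3, h4⟩ := exists_perronSteps_aux (v := v)
      (Finset.univ.sup fun i => (a i).natAbs) _ z₁ a (hz₁ hz) (hi₁ hi)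
      (fun i => Finset.le_sup (f := fun i => (a i).natAbs) (Finset.mem_univ i)) le_rfl hv
    refine ⟨z₂, h1.trans h3, ?_⟩
    rintro β (rfl | hβ)
    · exact h4
    · exact (perronSteps_invariant (N := v.ker) h3).2.2 (h2 β hβ)

end Perron

/-! ### Values of polynomials, and Perron steps as blow-ups -/

section Gauss

/-- The value of a polynomial at `(x, y)` is the least value of its terms, where the values of `x`
are independent modulo the value group of `K` and the residues of `y` are algebraically independent
over `KP`. -/
theorem exists_valuation_aeval_eq {V : ValuationSubring F} {σ β : Type*} [Fintype σ] [Fintype β]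
    {x : σ → F} (hx0 : ∀ i, x i ≠ 0)
    (hx : ∀ (c : K) (n : σ → ℤ), c ≠ 0 →
      V.valuation (algebraMap K F c) * ∏ i, V.valuation (x i) ^ n i = 1 → n = 0)
    {y : β → V} (hy : AlgebraicIndependent (residueSubfield K V) fun j => residue V (y j))
    {f : MvPolynomial (σ ⊕ β) K} (hf : f ≠ 0) :
    ∃ m₀ ∈ f.support,
      (∀ m ∈ f.support,
        V.valuation (algebraMap K F (f.coeff m) * ∏ i, x i ^ m (Sum.inl i)) ≤
          V.valuation (algebraMap K F (f.coeff m₀) * ∏ i, x i ^ m₀ (Sum.inl i))) ∧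
      V.valuation (MvPolynomial.aeval (Sum.elim x fun j => (y j : F)) f) =
        V.valuation (algebraMap K F (f.coeff m₀) * ∏ i, x i ^ m₀ (Sum.inl i)) := by
  classical
  set E : (σ ⊕ β →₀ ℕ) → F :=
    fun m => algebraMap K F (f.coeff m) * ∏ i, x i ^ m (Sum.inl i) with hE
  obtain ⟨m₀, hm₀, hmax⟩ := Finset.exists_max_image f.support (fun m => V.valuation (E m))
    (MvPolynomial.support_nonempty.2 hf)
  refine ⟨m₀, hm₀, hmax, ?_⟩
  have hc : ∀ m ∈ f.support, algebraMap K F (f.coeff m) ≠ 0 := fun m hm =>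
    (map_ne_zero _).2 (MvPolynomial.mem_support_iff.1 hm)
  have hEne : E m₀ ≠ 0 := mul_ne_zero (hc m₀ hm₀)
    (Finset.prod_ne_zero_iff.2 fun i _ => pow_ne_zero _ (hx0 i))
  have hvE : V.valuation (E m₀) ≠ 0 := (map_ne_zero _).2 hEne
  have hmem : ∀ m ∈ f.support, E m / E m₀ ∈ V := by
    intro m hm
    rw [← V.valuation_le_one_iff, map_div₀]
    exact (div_le_one₀ (zero_lt_iff.2 hvE)).2 (hmax m hm)
  let U : (σ ⊕ β →₀ ℕ) → V := fun m => if h : E m / E m₀ ∈ V then ⟨E m / E m₀, h⟩ else 0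
  have hU : ∀ m ∈ f.support, (U m : F) = E m / E m₀ := fun m hm => by simp [U, hmem m hm]
  let s : V := ∑ m ∈ f.support, U m * ∏ j, y j ^ m (Sum.inr j)
  have hs : (s : F) * E m₀ = MvPolynomial.aeval (Sum.elim x fun j => (y j : F)) f := by
    have h1 : (s : F) = ∑ m ∈ f.support, (U m : F) * ∏ j, (y j : F) ^ m (Sum.inr j) := by
      change V.subtype s = _
      simp only [s, map_sum, map_mul, map_prod, map_pow]
      rfl
    rw [h1, MvPolynomial.aeval_def, MvPolynomial.eval₂_eq', Finset.sum_mul]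
    refine Finset.sum_congr rfl fun m hm => ?_
    rw [hU m hm, Fintype.prod_sum_type]
    simp only [Sum.elim_inl, Sum.elim_inr]
    rw [div_mul_eq_mul_div, div_mul_cancel₀ _ hEne, hE]
    ring
  -- terms with the same `x`-exponent as the leading one have residue coefficients in `KP`,
  -- the others reduce to zero
  let κ : (σ ⊕ β →₀ ℕ) → residueSubfield K V := fun m =>
    if h : f.coeff m / f.coeff m₀ ∈ restrict K V ∧ ∀ i, m (Sum.inl i) = m₀ (Sum.inl i) then
      (ResidueField.map (restrictHom K V)).rangeRestrictField
        (residue _ ⟨f.coeff m / f.coeff m₀, h.1⟩) else 0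
  have hκ : ∀ m ∈ f.support, residue V (U m) = κ m := by
    intro m hm
    by_cases hmm : ∀ i, m (Sum.inl i) = m₀ (Sum.inl i)
    · have h1 : E m / E m₀ = algebraMap K F (f.coeff m / f.coeff m₀) := by
        have h2 : ∏ i, x i ^ m (Sum.inl i) = ∏ i, x i ^ m₀ (Sum.inl i) :=
          Finset.prod_congr rfl fun i _ => by rw [hmm i]
        have h3 := Finset.prod_ne_zero_iff.2 fun i (_ : i ∈ Finset.univ) =>
          pow_ne_zero (m₀ (Sum.inl i)) (hx0 i)
        simp only [hE]
        rw [h2, mul_div_mul_right _ _ h3, map_div₀]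
      have h2 : f.coeff m / f.coeff m₀ ∈ restrict K V := by
        rw [ValuationSubring.mem_comap, ← h1]
        exact hmem m hm
      have h3 : U m = restrictHom K V ⟨_, h2⟩ := Subtype.ext ((hU m hm).trans h1)
      have h4 : κ m = (ResidueField.map (restrictHom K V)).rangeRestrictField
        (residue _ ⟨f.coeff m / f.coeff m₀, h2⟩) := dif_pos ⟨h2, hmm⟩
      rw [h3, h4]
      rfl
    · have h1 : κ m = 0 := dif_neg fun h => hmm h.2
      rw [h1, ZeroMemClass.coe_zero, residue_eq_zero_iff, V.valuation_lt_one_iff, hU m hm]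
      refine lt_of_le_of_ne (V.valuation_le_one ⟨_, hmem m hm⟩) fun h2 => hmm fun i => ?_
      have h3 := hx (f.coeff m / f.coeff m₀)
        (fun i => (m (Sum.inl i) : ℤ) - m₀ (Sum.inl i))
        (div_ne_zero (MvPolynomial.mem_support_iff.1 hm) (MvPolynomial.mem_support_iff.1 hm₀)) (by
          rw [← h2]
          simp only [hE, map_div₀, map_mul, map_prod, map_pow]
          rw [mul_div_mul_comm, ← Finset.prod_div_distrib]
          congr 1
          refine Finset.prod_congr rfl fun i _ => ?_
          rw [zpow_sub₀ ((map_ne_zero _).2 (hx0 i)), zpow_natCast, zpow_natCast])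
      have h4 := congrFun h3 i
      simp only [Pi.zero_apply] at h4
      omega
  let pr : (σ ⊕ β →₀ ℕ) → (β →₀ ℕ) := fun m => m.comapDomain Sum.inr Sum.inr_injective.injOn
  let P : MvPolynomial β (residueSubfield K V) :=
    ∑ m ∈ f.support, MvPolynomial.monomial (pr m) (κ m)
  have hP : P ≠ 0 := by
    intro h0
    have h1 : P.coeff (pr m₀) = 1 := by
      simp only [P, MvPolynomial.coeff_sum, MvPolynomial.coeff_monomial]
      rw [Finset.sum_eq_single m₀]
      · have h2 : f.coeff m₀ / f.coeff m₀ = 1 :=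
          div_self (MvPolynomial.mem_support_iff.1 hm₀)
        have h3 : residue V (U m₀) = 1 := by
          have : U m₀ = 1 := Subtype.ext ((hU m₀ hm₀).trans (div_self hEne))
          rw [this, map_one]
        rw [if_pos rfl]
        exact Subtype.ext ((hκ m₀ hm₀).symm.trans h3)
      · intro m _ hne
        split_ifs with heq
        · have : ¬ ∀ i, m (Sum.inl i) = m₀ (Sum.inl i) := by
            intro hall
            apply hne
            ext (i | j)
            · exact hall i
            · exact DFunLike.congr_fun heq j
          exact dif_neg fun h => this h.2
        · rfl
      · exact fun h => absurd hm₀ h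
    rw [h0] at h1
    simp at h1
  have hPs : MvPolynomial.aeval (fun j => residue V (y j)) P = residue V s := by
    simp only [P, s, map_sum, map_mul, map_prod, map_pow]
    refine Finset.sum_congr rfl fun m hm => ?_
    rw [MvPolynomial.aeval_monomial, hκ m hm, Finsupp.prod_fintype _ _ (fun _ => pow_zero _)]
    rfl
  have hs1 : V.valuation (s : F) = 1 := by
    rw [← V.valuation_eq_one_iff]
    by_contra hu
    have h1 : residue V s = 0 := (residue_eq_zero_iff _).2 hu
    rw [← hPs] at h1
    exact hP (hy (h1.trans (map_zero _).symm))
  rw [← hs, map_mul, hs1, one_mul]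

/-- By the previous result a nonzero polynomial has, at `(x, y)`, the value of one of its terms. -/
theorem algebraicIndependent_of_valuation {V : ValuationSubring F} {σ β : Type*} [Fintype σ]
    [Fintype β] {x : σ → F} (hx0 : ∀ i, x i ≠ 0)
    (hx : ∀ (c : K) (n : σ → ℤ), c ≠ 0 →
      V.valuation (algebraMap K F c) * ∏ i, V.valuation (x i) ^ n i = 1 → n = 0)
    {y : β → V} (hy : AlgebraicIndependent (residueSubfield K V) fun j => residue V (y j)) :
    AlgebraicIndependent K (Sum.elim x fun j => (y j : F)) := by
  rw [algebraicIndependent_iff]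
  intro f hf
  by_contra hne
  obtain ⟨m₀, hm₀, -, hv⟩ := exists_valuation_aeval_eq hx0 hx hy hne
  rw [hf, map_zero, eq_comm, map_eq_zero, mul_eq_zero] at hv
  rcases hv with h | h
  · exact MvPolynomial.mem_support_iff.1 hm₀ ((map_eq_zero _).1 h)
  · exact Finset.prod_ne_zero_iff.2 (fun i _ => pow_ne_zero _ (hx0 i)) h

/-- Let the terms of `f` be `u m * E m * y ^ m`, with `u m` of value zero. If the quotients of the
`E m` lie in `D` as soon as they are integral, then `f(x, y)` is one of the `E m` times an element
of `D` of value zero. -/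
theorem exists_evalAt_eq_mul {V : ValuationSubring F} {σ β : ℕ} {x : Fin σ → F}
    (hx0 : ∀ i, x i ≠ 0)
    (hx : ∀ (c : K) (n : Fin σ → ℤ), c ≠ 0 →
      V.valuation (algebraMap K F c) * ∏ i, V.valuation (x i) ^ n i = 1 → n = 0)
    {y : Fin β → V} (hy : AlgebraicIndependent (residueSubfield K V) fun j => residue V (y j))
    {S : Subring K} {f : MvPolynomial (Fin σ ⊕ Fin β) S} (hf : f ≠ 0) {D : Subring F}
    (hyD : ∀ j, (y j : F) ∈ D) (u : (Fin σ ⊕ Fin β →₀ ℕ) → F) (E : (Fin σ ⊕ Fin β →₀ ℕ) → Fˣ)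
    (huD : ∀ m ∈ f.support, u m ∈ D) (hu : ∀ m ∈ f.support, V.valuation (u m) = 1)
    (hE : ∀ m ∈ f.support,
      algebraMap K F ((f.coeff m : S) : K) * ∏ i, x i ^ m (Sum.inl i) = u m * E m)
    (hED : ∀ m ∈ f.support, ∀ m' ∈ f.support, V.valuation (E m / E m' : F) ≤ 1 →
      (E m / E m' : F) ∈ D) :
    ∃ m₀ ∈ f.support, ∃ s ∈ D, V.valuation s = 1 ∧
      evalAt S x (fun j => (y j : F)) f = E m₀ * s := by
  have hinj : Function.Injective S.subtype := Subtype.val_injective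
  have hf' : MvPolynomial.map S.subtype f ≠ 0 := fun h =>
    hf (MvPolynomial.map_injective _ hinj (h.trans (map_zero _).symm))
  have hsupp : (MvPolynomial.map S.subtype f).support = f.support :=
    MvPolynomial.support_map_of_injective f hinj
  have hev : evalAt S x (fun j => (y j : F)) f =
      MvPolynomial.aeval (Sum.elim x fun j => (y j : F)) (MvPolynomial.map S.subtype f) := by
    rw [MvPolynomial.aeval_def, MvPolynomial.eval₂_map]
    rfl
  obtain ⟨m₀, hm₀, hmax, hv⟩ := exists_valuation_aeval_eq hx0 hx hy hf'
  rw [hsupp] at hm₀ hmax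
  simp only [MvPolynomial.coeff_map, Subring.subtype_apply] at hmax hv
  rw [← hev] at hv
  have hvE : ∀ m ∈ f.support,
      V.valuation (algebraMap K F ((f.coeff m : S) : K) * ∏ i, x i ^ m (Sum.inl i)) =
        V.valuation (E m : F) := fun m hm => by rw [hE m hm, map_mul, hu m hm, one_mul]
  have hE0 : V.valuation (E m₀ : F) ≠ 0 := (map_ne_zero _).2 (E m₀).ne_zero
  rw [hvE m₀ hm₀] at hv
  refine ⟨m₀, hm₀, evalAt S x (fun j => (y j : F)) f / E m₀, ?_, ?_, ?_⟩
  · have h1 : evalAt S x (fun j => (y j : F)) f / E m₀ =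
        ∑ m ∈ f.support, u m * (E m / E m₀ : F) * ∏ j, (y j : F) ^ m (Sum.inr j) := by
      rw [evalAt, MvPolynomial.eval₂_eq', Finset.sum_div]
      refine Finset.sum_congr rfl fun m hm => ?_
      rw [Fintype.prod_sum_type]
      simp only [Sum.elim_inl, Sum.elim_inr, RingHom.comp_apply, Subring.subtype_apply]
      rw [← mul_assoc, hE m hm]
      ring
    rw [h1]
    refine sum_mem fun m hm => mul_mem (mul_mem (huD m hm) (hED m hm m₀ hm₀ ?_))
      (prod_mem fun j _ => pow_mem (hyD j) _)
    rw [map_div₀]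
    refine (div_le_one₀ (zero_lt_iff.2 hE0)).2 ?_
    rw [← hvE m hm, ← hvE m₀ hm₀]
    exact hmax m hm
  · rw [map_div₀, hv, div_self hE0]
  · rw [mul_div_cancel₀ _ (E m₀).ne_zero]

end Gauss

/-- The place on the units of `F`, in multiplicative notation. -/
noncomputable def unitsValuation (V : ValuationSubring F) : Fˣ →* V.ValueGroup :=
  (V.valuation : F →* V.ValueGroup).comp (Units.coeHom F)

theorem unitsValuation_apply (V : ValuationSubring F) (a : Fˣ) :
    unitsValuation V a = V.valuation (a : F) := rfl

theorem polySubring_le_valuationSubring {V : ValuationSubring F} {S : LocalSubring K}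
    (hS : S ≤ (restrict K V).toLocalSubring) {ι β : Type*} {z : ι → Fˣ}
    (hz : ∀ i, unitsValuation V (z i) < 1) (y : β → V) :
    polySubring S.toSubring (fun i => (z i : F)) (fun j => (y j : F)) ≤ V.toSubring :=
  polySubring_le (fun _ hc => algebraMap_mem_of_le hS hc)
    (fun i => (V.valuation_le_one_iff _).1 (hz i).le) fun j => (y j).2

/-- A step of Perron's algorithm amounts to blowing up the local ring of `S[z, y]`. -/
theorem hasRegularParameters_perronStep {V : ValuationSubring F} {S : LocalSubring K}
    (hS : S ≤ (restrict K V).toLocalSubring) {ι κ β : Type*} [Fintype ι] [Fintype κ]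
    [DecidableEq ι] {z z' : ι → Fˣ} {w : κ → F} {y : β → V}
    (hz : ∀ i, unitsValuation V (z i) < 1) (hz' : ∀ i, unitsValuation V (z' i) < 1)
    (h : PerronStep (unitsValuation V) z z')
    (hreg : HasRegularParameters
      (localizationAtCenter V _ (polySubring_le_valuationSubring hS hz y))
      (Sum.elim (fun i => (z i : F)) w)) :
    HasRegularParameters (localizationAtCenter V _ (polySubring_le_valuationSubring hS hz' y))
      (Sum.elim (fun i => (z' i : F)) w) := by
  classical
  obtain ⟨i, j, hij, hv, rfl⟩ := h
  set G := polySubring S.toSubring (fun i => (z i : F)) (fun j => (y j : F)) with hG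
  have hGV : G ≤ V.toSubring := polySubring_le_valuationSubring hS hz y
  set z' := Function.update z i (z i / z j) with hzz'
  set G' := polySubring S.toSubring (fun i => (z' i : F)) (fun j => (y j : F)) with hG'
  have hGV' : G' ≤ V.toSubring := polySubring_le_valuationSubring hS hz' y
  have hzi : (z' i : F) = z i / z j := by simp [hzz']
  have hzk : ∀ k, k ≠ i → (z' k : F) = z k := fun k hk => by simp [hzz', hk]
  have hGG' : G ≤ G' := by
    refine polySubring_le (fun c hc => algebraMap_mem_polySubring hc) (fun k => ?_)
      fun j => right_mem_polySubring j
    by_cases hk : k = i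
    · subst hk
      have h1 : (z k : F) = z' k * z' j := by
        rw [hzi, hzk j hij.symm, div_mul_cancel₀ _ (z j).ne_zero]
      rw [h1]
      exact mul_mem (left_mem_polySubring (x := fun i => (z' i : F)) k)
        (left_mem_polySubring (x := fun i => (z' i : F)) j)
    · rw [← hzk k hk]
      exact left_mem_polySubring (x := fun i => (z' i : F)) k
  set A := localizationAtCenter V G hGV with hA
  have hAV := localizationAtCenter_le hGV
  set D := Subring.closure ((A.toSubring : Set F) ∪ {(z i / z j : F)}) with hD
  have hwV : V.valuation (z i / z j : F) < 1 := by
    have := hv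
    rwa [unitsValuation_apply, Units.val_div_eq_div_val] at this
  have hDV : D ≤ V.toSubring := by
    rw [hD, Subring.closure_le]
    rintro a (ha | rfl)
    · exact (le_toLocalSubring_iff.1 hAV).1 ha
    · exact (V.valuation_le_one_iff _).1 hwV.le
  have hAG' : A.toSubring ≤ (localizationAtCenter V G' hGV').toSubring := by
    intro b hb
    obtain ⟨a, ha, s, hs, hs1, rfl⟩ := (mem_localizationAtCenter hGV).1 hb
    exact (mem_localizationAtCenter hGV').2 ⟨a, hGG' ha, s, hGG' hs, hs1, rfl⟩
  have hG'D : G' ≤ D := by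
    have hGA : G ≤ D := (le_localizationAtCenter hGV).trans fun a ha =>
      Subring.subset_closure (.inl ha)
    refine polySubring_le (fun c hc => hGA (algebraMap_mem_polySubring hc)) (fun k => ?_)
      fun j => hGA (right_mem_polySubring j)
    by_cases hk : k = i
    · subst hk
      rw [hzi]
      exact Subring.subset_closure (.inr rfl)
    · rw [hzk k hk]
      exact hGA (left_mem_polySubring (x := fun i => (z i : F)) k)
  have hDG' : D ≤ (localizationAtCenter V G' hGV').toSubring := by
    rw [hD, Subring.closure_le]
    rintro a (ha | rfl)
    · exact hAG' ha
    · rw [← hzi]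
      exact le_localizationAtCenter hGV' (left_mem_polySubring (x := fun i => (z' i : F)) i)
  have h1 := hreg.blowup hAV (i := Sum.inl i) (j := Sum.inl j) (by simpa using hij)
    (z j).ne_zero hwV hDV
  have h2 : Function.update (Sum.elim (fun i => (z i : F)) w) (Sum.inl i)
      (Sum.elim (fun i => (z i : F)) w (Sum.inl i) / Sum.elim (fun i => (z i : F)) w (Sum.inl j)) =
      Sum.elim (fun i => (z' i : F)) w := by
    rw [Sum.update_elim_inl]
    congr 1
    funext k
    by_cases hk : k = i
    · subst hk
      simp [hzi]
    · simp [hk, hzk]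
  rw [h2] at h1
  rwa [← localizationAtCenter_eq_of_le hGV' hDV hG'D hDG']

theorem hasRegularParameters_perronSteps {V : ValuationSubring F} {S : LocalSubring K}
    (hS : S ≤ (restrict K V).toLocalSubring) {ι κ β : Type*} [Fintype ι] [Fintype κ]
    [DecidableEq ι] {z z' : ι → Fˣ} {w : κ → F} {y : β → V}
    (h : Relation.ReflTransGen (PerronStep (unitsValuation V)) z z')
    (hz : ∀ i, unitsValuation V (z i) < 1)
    (hreg : HasRegularParameters
      (localizationAtCenter V _ (polySubring_le_valuationSubring hS hz y))
      (Sum.elim (fun i => (z i : F)) w)) :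
    ∃ hz' : ∀ i, unitsValuation V (z' i) < 1, HasRegularParameters
      (localizationAtCenter V _ (polySubring_le_valuationSubring hS hz' y))
      (Sum.elim (fun i => (z' i : F)) w) := by
  induction h with
  | refl => exact ⟨hz, hreg⟩
  | tail _ h ih =>
    obtain ⟨hz₁, hreg₁⟩ := ih
    exact ⟨perronStep_lt_one hz₁ h,
      hasRegularParameters_perronStep hS hz₁ (perronStep_lt_one hz₁ h) h hreg₁⟩

/-! ### Essential finiteness of monoidal transforms, affine models -/

section Birational

theorem closure_union_eq_polySubring (R : Subring K) (s : Set K) :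
    Subring.closure ((R : Set K) ∪ s) =
      polySubring R (Subtype.val : s → K) (Empty.elim : Empty → K) := by
  simp [polySubring, Set.range_eq_empty]

theorem isNoetherianRing_closure_union (R : Subring K) [IsNoetherianRing R] {s : Set K}
    (hs : s.Finite) : IsNoetherianRing (Subring.closure ((R : Set K) ∪ s)) := by
  have := hs.to_subtype
  rw [closure_union_eq_polySubring]
  infer_instance

/-- Iterated monoidal transforms are essentially of finite type: they are local rings of finitely
generated algebras. -/
theorem exists_finite_of_isIteratedMonoidalTransform {v : ValuationSubring K}
    {R R' : LocalSubring K} [IsNoetherianRing R.toSubring] (hR : R ≤ v.toLocalSubring)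
    (h : IsIteratedMonoidalTransform v R R') :
    ∃ s : Set K, s.Finite ∧ ∃ hs : Subring.closure ((R.toSubring : Set K) ∪ s) ≤ v.toSubring,
      R' = localizationAtCenter v _ hs := by
  induction h with
  | refl =>
    have h0 : Subring.closure ((R.toSubring : Set K) ∪ ∅) = R.toSubring := by simp
    have hRv := (le_toLocalSubring_iff.1 hR).1
    refine ⟨∅, Set.finite_empty, h0.le.trans hRv, ?_⟩
    exact (localizationAtCenter_self hR).symm.trans
      (localizationAtCenter_eq_of_le (h0.le.trans hRv) hRv h0.le
        (h0.ge.trans (le_localizationAtCenter _)))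
  | @tail R₁ R₂ _ h ih =>
    obtain ⟨s, hs, hsv, rfl⟩ := ih
    set A := Subring.closure ((R.toSubring : Set K) ∪ s) with hA
    obtain ⟨p, x, -, -, -, -, hB, rfl⟩ := h
    set B := Subring.closure (((localizationAtCenter v A hsv).toSubring : Set K) ∪
      {b | ∃ a ∈ p, b = (x : K)⁻¹ * (a : K)}) with hBdef
    have hN : IsNoetherianRing A := isNoetherianRing_closure_union _ hs
    have hN' : IsNoetherianRing (localizationAtCenter v A hsv).toSubring :=
      IsLocalization.isNoetherianRing (centerIdeal v A hsv).primeCompl _ hN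
    obtain ⟨T, hT⟩ := (IsNoetherian.noetherian p : p.FG)
    let s' : Set K := s ∪ (fun a : (localizationAtCenter v A hsv).toSubring => (x : K)⁻¹ * a) '' T
    set A' := Subring.closure ((R.toSubring : Set K) ∪ s') with hA'
    have hAA' : A ≤ A' :=
      Subring.closure_mono (Set.union_subset_union_right _ Set.subset_union_left)
    have hTA' : ∀ a ∈ T, (x : K)⁻¹ * a ∈ A' := fun a ha =>
      Subring.subset_closure (.inr (.inr ⟨a, ha, rfl⟩))
    have hA'B : A' ≤ B := by
      rw [hA', Subring.closure_le]
      rintro b (hb | hb | ⟨a, ha, rfl⟩)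
      · exact Subring.subset_closure (.inl (le_localizationAtCenter hsv
          (Subring.subset_closure (.inl hb))))
      · exact Subring.subset_closure (.inl (le_localizationAtCenter hsv
          (Subring.subset_closure (.inr hb))))
      · exact Subring.subset_closure (.inr ⟨a, hT ▸ Ideal.subset_span ha, rfl⟩)
    have hA'v : A' ≤ v.toSubring := hA'B.trans hB
    have hloc : (localizationAtCenter v A hsv).toSubring ≤
        (localizationAtCenter v A' hA'v).toSubring := by
      intro b hb
      obtain ⟨a, ha, c, hc, hc1, rfl⟩ := (mem_localizationAtCenter hsv).1 hb
      exact (mem_localizationAtCenter hA'v).2 ⟨a, hAA' ha, c, hAA' hc, hc1, rfl⟩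
    have hBA' : B ≤ (localizationAtCenter v A' hA'v).toSubring := by
      rw [hBdef, Subring.closure_le]
      rintro b (hb | ⟨a, ha, rfl⟩)
      · exact hloc hb
      · rw [← hT] at ha
        induction ha using Submodule.span_induction with
        | mem a ha => exact le_localizationAtCenter hA'v (hTA' a ha)
        | zero => simp
        | add a b _ _ ha hb =>
          rw [Subring.coe_add, mul_add]
          exact add_mem ha hb
        | smul r a _ ha =>
          rw [smul_eq_mul, Subring.coe_mul, mul_left_comm]
          exact mul_mem (hloc r.2) ha
    exact ⟨s', hs.union (T.finite_toSet.image _), hA'v,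
      localizationAtCenter_eq_of_le hA'v hB hA'B hBA'⟩

open Polynomial in
/-- Adjoining a fraction `p / q` does not raise the dimension: `A[p / q]` is a quotient of `A[X]`,
of dimension `dim A + 1`, by an ideal that contains the regular element `q X - p`. -/
theorem ringKrullDim_closure_union_singleton_le {A : Subring K} [IsNoetherianRing A] {a p q : K}
    (hp : p ∈ A) (hq : q ∈ A) (hq0 : q ≠ 0) (ha : a = p / q) :
    ringKrullDim (Subring.closure ((A : Set K) ∪ {a})) ≤ ringKrullDim A := by
  have hev := closure_union_singleton_eq_range A a
  let ψ : A[X] →+* Subring.closure ((A : Set K) ∪ {a}) :=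
    (Polynomial.eval₂RingHom A.subtype a).codRestrict _ fun f => hev ▸ ⟨f, rfl⟩
  have hψ : Function.Surjective ψ := by
    rintro ⟨g, hg⟩
    obtain ⟨f, rfl⟩ : g ∈ (Polynomial.eval₂RingHom A.subtype a).range := hev ▸ hg
    exact ⟨f, rfl⟩
  have hg : (C ⟨q, hq⟩ * X - C ⟨p, hp⟩ : A[X]) ≠ 0 := by
    intro h
    have := congrArg (fun f => Polynomial.coeff f 1) h
    simp [Polynomial.coeff_C] at this
    exact hq0 this
  have hψg : ψ (C ⟨q, hq⟩ * X - C ⟨p, hp⟩) = 0 := by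
    apply Subtype.ext
    change Polynomial.eval₂RingHom A.subtype a _ = 0
    simp [ha, mul_div_cancel₀ _ hq0]
  have h1 := ringKrullDim_succ_le_of_surjective ψ hψ (mem_nonZeroDivisors_of_ne_zero hg) hψg
  rw [Polynomial.ringKrullDim_of_isNoetherianRing] at h1
  exact ENat.WithBot.add_le_add_one_right_iff.1 h1

theorem ringKrullDim_closure_union_le (R : Subring K) [IsNoetherianRing R] [IsFractionRing R K]
    {s : Set K} (hs : s.Finite) :
    ringKrullDim (Subring.closure ((R : Set K) ∪ s)) ≤ ringKrullDim R := by
  induction s, hs using Set.Finite.induction_on with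
  | empty =>
    have h0 : Subring.closure ((R : Set K) ∪ ∅) = R := by simp
    rw [h0]
  | @insert a s _ hs ih =>
    have := isNoetherianRing_closure_union R hs
    obtain ⟨p, q, hq, hpq⟩ := IsFractionRing.div_surjective (A := R) a
    have hle : ∀ c : R, (c : K) ∈ Subring.closure ((R : Set K) ∪ s) := fun c =>
      Subring.subset_closure (.inl c.2)
    have h1 := ringKrullDim_closure_union_singleton_le (A := Subring.closure ((R : Set K) ∪ s))
      (hle p) (hle q) (a := a) (by
        have := nonZeroDivisors.ne_zero hq
        simpa using this) hpq.symm
    have h2 : Subring.closure ((Subring.closure ((R : Set K) ∪ s) : Set K) ∪ {a}) =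
        Subring.closure ((R : Set K) ∪ insert a s) := by
      rw [Subring.closure_union, Subring.closure_eq, ← Subring.closure_union, Set.union_assoc,
        Set.union_singleton]
    rw [h2] at h1
    exact h1.trans ih

theorem ringKrullDim_localizationAtCenter_le {V : ValuationSubring F} {G : Subring F}
    (hG : G ≤ V.toSubring) :
    ringKrullDim (localizationAtCenter V G hG).toSubring ≤ ringKrullDim G := by
  rw [IsLocalization.AtPrime.ringKrullDim_eq_height (centerIdeal V G hG)]
  exact Ideal.height_le_ringKrullDim_of_isPrime

end Birational

section Models

theorem finiteType_polySubring (S : Subring K) {ι β : Type*} [Finite ι] [Finite β] (x : ι → F)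
    (y : β → F) :
    (((algebraMap K F).comp S.subtype).codRestrict (polySubring S x y)
      fun c => algebraMap_mem_polySubring c.2).FiniteType := by
  let ρ : S →+* polySubring S x y := ((algebraMap K F).comp S.subtype).codRestrict
    (polySubring S x y) fun c => algebraMap_mem_polySubring c.2
  let e : MvPolynomial (ι ⊕ β) S →+* F :=
    MvPolynomial.eval₂Hom ((algebraMap K F).comp S.subtype) (Sum.elim x y)
  have he : polySubring S x y = e.range := polySubring_eq_range
  let e' : MvPolynomial (ι ⊕ β) S →+* polySubring S x y := e.codRestrict _ fun f => he ▸ ⟨f, rfl⟩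
  have he' : Function.Surjective e' := by
    rintro ⟨g, hg⟩
    obtain ⟨f, rfl⟩ : g ∈ e.range := he ▸ hg
    exact ⟨f, rfl⟩
  have h1 : ρ = e'.comp MvPolynomial.C := by
    ext c
    change algebraMap K F c = e (MvPolynomial.C c)
    simp [e]
  change ρ.FiniteType
  rw [h1]
  refine RingHom.FiniteType.comp_surjective ?_ he'
  have : Algebra.FiniteType S (MvPolynomial (ι ⊕ β) S) := inferInstance
  exact RingHom.finiteType_algebraMap.2 this

variable {R : LocalSubring K} {G : Subring F}

/-- The germ at the generic point is the structure map that Mathlib puts on the function field of an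
affine scheme. -/
theorem germ_genericPoint_eq_algebraMap (A : CommRingCat.{u}) [IsDomain A] (a : A) :
    ((Spec A).presheaf.germ ⊤ (genericPoint (Spec A)) trivial).hom
      ((Scheme.ΓSpecIso A).inv.hom a) = algebraMap A (Spec A).functionField a := by
  rfl

theorem algebraMap_stalk_functionField (A : CommRingCat.{u}) [IsDomain A] (p : Spec A) (a : A) :
    algebraMap ((Spec A).presheaf.stalk p) (Spec A).functionField
      ((StructureSheaf.toStalk A p).hom a) = algebraMap A (Spec A).functionField a := by
  exact congrArg (fun f => f.hom a) (StructureSheaf.toStalk_stalkSpecializes (R := A)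
    (x := genericPoint (Spec A)) (y := p) ((genericPoint_spec (Spec A)).specializes trivial))

/-- The function field of the spectrum of a domain is its fraction field. -/
noncomputable def specFunctionFieldEquiv (A : CommRingCat.{u}) [IsDomain A] [Algebra A F]
    [IsFractionRing A F] : (Spec A).functionField ≃+* F :=
  (IsLocalization.algEquiv (nonZeroDivisors A) (Spec A).functionField F).toRingEquiv

theorem specFunctionFieldEquiv_algebraMap (A : CommRingCat.{u}) [IsDomain A] [Algebra A F]
    [IsFractionRing A F] (a : A) :
    specFunctionFieldEquiv A (algebraMap A (Spec A).functionField a) = algebraMap A F a :=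
  (IsLocalization.algEquiv (nonZeroDivisors A) (Spec A).functionField F).commutes a

instance (G : Subring F) : IsDomain (CommRingCat.of G) := inferInstanceAs (IsDomain G)

/-- The function field of the spectrum of a subring `G` of `F` with fraction field `F`. -/
noncomputable def specSubringFunctionFieldEquiv (G : Subring F) [h : IsFractionRing G F] :
    (Spec (CommRingCat.of G)).functionField ≃+* F :=
  letI : Algebra (CommRingCat.of G) F := inferInstanceAs (Algebra G F)
  haveI : IsFractionRing (CommRingCat.of G) F := h
  specFunctionFieldEquiv (CommRingCat.of G)

theorem specSubringFunctionFieldEquiv_toStalk (G : Subring F) [h : IsFractionRing G F]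
    (p : Spec (CommRingCat.of G)) (a : G) :
    specSubringFunctionFieldEquiv G ((algebraMap ((Spec (CommRingCat.of G)).presheaf.stalk p) _)
      ((StructureSheaf.toStalk (CommRingCat.of G) p).hom a)) = a :=
  letI : Algebra (CommRingCat.of G) F := inferInstanceAs (Algebra G F)
  haveI : IsFractionRing (CommRingCat.of G) F := h
  (congrArg (specFunctionFieldEquiv (CommRingCat.of G))
    (algebraMap_stalk_functionField (CommRingCat.of G) p a)).trans
      (specFunctionFieldEquiv_algebraMap (CommRingCat.of G) a)

theorem specSubringFunctionFieldEquiv_germ (G : Subring F) [h : IsFractionRing G F] (a : G) :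
    specSubringFunctionFieldEquiv G (((Spec (CommRingCat.of G)).presheaf.germ ⊤
      (genericPoint (Spec (CommRingCat.of G))) trivial).hom
        ((Scheme.ΓSpecIso (CommRingCat.of G)).inv.hom a)) = a :=
  letI : Algebra (CommRingCat.of G) F := inferInstanceAs (Algebra G F)
  haveI : IsFractionRing (CommRingCat.of G) F := h
  (congrArg (specFunctionFieldEquiv (CommRingCat.of G))
    (germ_genericPoint_eq_algebraMap (CommRingCat.of G) a)).trans
      (specFunctionFieldEquiv_algebraMap (CommRingCat.of G) a)

/-- The affine model with coordinate ring `G`, a subring of `F` of finite type over `R` with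
fraction field `F`. -/
noncomputable def affineModel (hRG : ∀ c : R.toSubring, algebraMap K F c ∈ G)
    (hft : (((algebraMap K F).comp R.toSubring.subtype).codRestrict G hRG).FiniteType)
    [IsFractionRing G F] : Model R F where
  X := Spec (CommRingCat.of G)
  toBase := Spec.map (CommRingCat.ofHom
    (((algebraMap K F).comp R.toSubring.subtype).codRestrict G hRG))
  isIntegral := inferInstance
  isSeparated := inferInstance
  locallyOfFiniteType := (HasRingHomProperty.Spec_iff (P := @LocallyOfFiniteType)).2 hft
  quasiCompact := inferInstance
  functionFieldEquiv := specSubringFunctionFieldEquiv G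
  compatible r := by
    have h := congrArg (fun f => f.hom r) (Scheme.ΓSpecIso_inv_naturality (CommRingCat.ofHom
      (((algebraMap K F).comp R.toSubring.subtype).codRestrict G hRG)))
    have h2 := specSubringFunctionFieldEquiv_germ G
      ((((algebraMap K F).comp R.toSubring.subtype).codRestrict G hRG) r)
    refine Eq.trans ?_ h2
    refine congrArg (fun z => specSubringFunctionFieldEquiv G
      (((Spec (CommRingCat.of G)).presheaf.germ ⊤ (genericPoint _) trivial).hom z)) ?_
    exact h.symm

variable {V : ValuationSubring F} (hRG : ∀ c : R.toSubring, algebraMap K F c ∈ G)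
    (hft : (((algebraMap K F).comp R.toSubring.subtype).codRestrict G hRG).FiniteType)
    [IsFractionRing G F] (hG : G ≤ V.toSubring)

/-- The center of `V` on the affine model with coordinate ring `G`. -/
def affineCenter : (affineModel hRG hft).X :=
  (⟨centerIdeal V G hG, inferInstance⟩ : PrimeSpectrum G)

/-- The local ring of the affine model at the center of `V` is the localization at the center. -/
noncomputable def stalkAffineCenterEquiv :
    (affineModel hRG hft).X.presheaf.stalk (affineCenter hRG hft hG) ≃+*
      (localizationAtCenter V G hG).toSubring :=
  letI p : PrimeSpectrum G := ⟨centerIdeal V G hG, inferInstance⟩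
  haveI : IsLocalization (centerIdeal V G hG).primeCompl
      ((Spec.structureSheaf G).presheaf.stalk p) := StructureSheaf.IsLocalization.to_stalk G p
  (IsLocalization.algEquiv (centerIdeal V G hG).primeCompl
    ((Spec.structureSheaf G).presheaf.stalk p) (localizationAtCenter V G hG).toSubring).toRingEquiv

theorem coe_stalkAffineCenterEquiv (z) : (stalkAffineCenterEquiv hRG hft hG z : F) =
    (affineModel hRG hft).functionFieldEquiv (algebraMap _ _ z) := by
  let p : PrimeSpectrum G := ⟨centerIdeal V G hG, inferInstance⟩
  have : IsLocalization (centerIdeal V G hG).primeCompl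
      ((Spec.structureSheaf G).presheaf.stalk p) := StructureSheaf.IsLocalization.to_stalk G p
  have key : (localizationAtCenter V G hG).toSubring.subtype.comp
      (stalkAffineCenterEquiv hRG hft hG).toRingHom =
      ((affineModel hRG hft).functionFieldEquiv.toRingHom.comp (algebraMap
        ((affineModel hRG hft).X.presheaf.stalk (affineCenter hRG hft hG)) _)) := by
    refine IsLocalization.ringHom_ext (R := G) (S := (Spec.structureSheaf G).presheaf.stalk p)
      (centerIdeal V G hG).primeCompl ?_
    ext g
    have h1 := specSubringFunctionFieldEquiv_toStalk G p g
    refine Eq.trans ?_ h1.symm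
    have h2 : stalkAffineCenterEquiv hRG hft hG
        (algebraMap G ((Spec.structureSheaf G).presheaf.stalk p) g) =
          algebraMap G (localizationAtCenter V G hG).toSubring g :=
      (IsLocalization.algEquiv (centerIdeal V G hG).primeCompl
        ((Spec.structureSheaf G).presheaf.stalk p)
        (localizationAtCenter V G hG).toSubring).commutes g
    exact congrArg Subtype.val h2
  exact congrArg (fun f => f z) key

theorem localRing_affineCenter :
    (affineModel hRG hft).localRing (affineCenter hRG hft hG) = localizationAtCenter V G hG := by
  apply LocalSubring.toSubring_injective
  ext z
  constructor
  · rintro ⟨w, rfl⟩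
    have := coe_stalkAffineCenterEquiv hRG hft hG w
    exact this ▸ Subtype.prop _
  · intro hz
    refine ⟨(stalkAffineCenterEquiv hRG hft hG).symm ⟨z, hz⟩, ?_⟩
    refine (coe_stalkAffineCenterEquiv hRG hft hG _).symm.trans ?_
    rw [RingEquiv.apply_symm_apply]

theorem isCenter_affineCenter :
    (affineModel hRG hft).IsCenter V (affineCenter hRG hft hG) := by
  rw [Model.IsCenter, localRing_affineCenter]
  exact localizationAtCenter_le hG

theorem isAffineSpace_affineModel {n : ℕ} (e : MvPolynomial (ULift.{u} (Fin n)) R.toSubring ≃+* G)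
    (he : ∀ c : R.toSubring, (e (MvPolynomial.C c) : F) = algebraMap K F c) :
    (affineModel hRG hft).IsAffineSpace n := by
  let i : CommRingCat.of (MvPolynomial (ULift.{u} (Fin n)) R.toSubring) ≅ CommRingCat.of G :=
    e.toCommRingCatIso
  refine ⟨Scheme.Spec.mapIso i.op ≪≫
    (AffineSpace.SpecIso (ULift.{u} (Fin n)) (CommRingCat.of R.toSubring)).symm, ?_⟩
  have h := AffineSpace.SpecIso_inv_over (n := ULift.{u} (Fin n)) (CommRingCat.of R.toSubring)
  refine (Category.assoc _ _ _).trans ?_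
  refine (congrArg (fun f => Spec.map i.hom ≫ f) h).trans ?_
  refine (Spec.map_comp _ _).symm.trans (congrArg Spec.map ?_)
  ext c
  exact he c

end Models

/-! ### The initial parameters -/

section Initial

theorem IndepMod.eq_one_of_mem {ι G : Type*} [CommGroup G] [Fintype ι] {N : Subgroup G} {z : ι → G}
    (hz : IndepMod N z) {α : G} (hα : α ∈ Subgroup.closure (Set.range z)) (hN : α ∈ N) :
    α = 1 := by
  obtain ⟨a, rfl⟩ := Subgroup.exists_of_mem_closure_range _ _ hα
  rw [hz a hN]
  simp

/-- The units of `F` whose value lies in the value group of `K`. -/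
noncomputable def baseValued (K : Type u) {F : Type u} [Field K] [Field F] [Algebra K F]
    (V : ValuationSubring F) : Subgroup Fˣ :=
  (((unitsValuation V).comp (Units.map (algebraMap K F : K →* F))).toHomUnits.range).comap
    (unitsValuation V).toHomUnits

theorem mem_baseValued {V : ValuationSubring F} {a : Fˣ} :
    a ∈ baseValued K V ↔ ∃ c : K, c ≠ 0 ∧ V.valuation (a : F) = V.valuation (algebraMap K F c) := by
  rw [baseValued, Subgroup.mem_comap, MonoidHom.mem_range]
  constructor
  · rintro ⟨c, hc⟩
    exact ⟨c, c.ne_zero, (congrArg Units.val hc).symm⟩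
  · rintro ⟨c, hc, h⟩
    exact ⟨Units.mk0 c hc, Units.ext h.symm⟩

variable {V : ValuationSubring F} {ρ τ : ℕ} {x : Fin ρ → F} {y : Fin τ → V}

theorem ConditionT.ne_zero (hT : ConditionT K V x y) (i : Fin ρ) : x i ≠ 0 :=
  hT.isTranscendenceBasis.1.ne_zero (Sum.inl i)

/-- By the directness of the sum of value groups, no `x i` has value zero. -/
theorem ConditionT.valuation_ne_one (hT : ConditionT K V x y) (i : Fin ρ) :
    V.valuation (x i) ≠ 1 := by
  intro h
  have h1 := hT.value_independent 1 (Pi.single i 1) one_ne_zero (by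
    rw [map_one, map_one, one_mul]
    refine Finset.prod_eq_one fun j _ => ?_
    by_cases hj : j = i
    · subst hj
      rw [h, one_zpow]
    · rw [Pi.single_eq_of_ne hj, zpow_zero])
  simpa using congrFun h1 i

/-- Each `x i` or its inverse has positive value. -/
theorem ConditionT.exists_zpow (hT : ConditionT K V x y) (i : Fin ρ) :
    ∃ (a : Fˣ) (e : ℤ), e * e = 1 ∧ (a : F) = x i ^ e ∧ unitsValuation V a < 1 := by
  rcases lt_or_gt_of_ne (hT.valuation_ne_one i) with h | h
  · exact ⟨Units.mk0 _ (hT.ne_zero i), 1, rfl, by simp, h⟩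
  · refine ⟨(Units.mk0 _ (hT.ne_zero i))⁻¹, -1, rfl, by simp, ?_⟩
    rw [map_inv]
    exact inv_lt_one_of_one_lt₀ h

variable {S : LocalSubring K} {d : ℕ} {t : Fin d → S.toSubring} {O : Set (Fin d)}

/-- The first family to which Perron's algorithm is applied: the `x i`, inverted where their value
is negative, together with the parameters `t k`, `k ∈ O`. -/
theorem exists_initial_family (hT : ConditionT K V x y) (hS : S ≤ (restrict K V).toLocalSubring)
    [IsNoetherianRing S.toSubring] (ht : IsRegularParameterSystem t) (ht0 : ∀ k ∈ O, t k ≠ 0)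
    (hO : ∀ n : Fin d → ℤ, (∀ k, k ∉ O → n k = 0) →
      ∏ k, V.valuation (algebraMap K F (t k : K)) ^ n k = 1 → n = 0)
    [Fintype O] [Fintype ↥Oᶜ] :
    ∃ (z : Fin ρ ⊕ O → Fˣ) (hz : ∀ i, unitsValuation V (z i) < 1),
      (∀ i, ∃ a ∈ Subgroup.closure (Set.range z), (a : F) = x i) ∧
      (∀ k : O, (z (Sum.inr k) : F) = algebraMap K F (t k)) ∧
      IndepMod (unitsValuation V).ker z ∧ (O = ∅ → IndepMod (baseValued K V) z) ∧
      HasRegularParameters (localizationAtCenter V _ (polySubring_le_valuationSubring hS hz y))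
        (Sum.elim (fun i => (z i : F)) fun k : ↥Oᶜ => algebraMap K F (t k)) := by
  classical
  choose a e he hae ha using hT.exists_zpow
  have htF : ∀ k : O, algebraMap K F (t k) ≠ 0 := fun k h =>
    ht0 k k.2 (Subtype.ext ((map_eq_zero _).1 h))
  have htv : ∀ k, V.valuation (algebraMap K F (t k)) < 1 := fun k => by
    rw [← valuation_restrict_lt_one_iff, ← mem_maximalIdeal_iff_valuation hS, ← ht.2]
    exact Ideal.subset_span ⟨k, rfl⟩
  let z : Fin ρ ⊕ O → Fˣ := Sum.elim a fun k => Units.mk0 _ (htF k)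
  have hz : ∀ i, unitsValuation V (z i) < 1 := by
    rintro (i | k)
    exacts [ha i, htv k]
  -- inverting some of the `x i` does not affect the independence of their values
  have hprod : ∀ (c : K) (n : Fin ρ → ℤ), c ≠ 0 →
      V.valuation (algebraMap K F c) * ∏ i, V.valuation (a i : F) ^ n i = 1 → n = 0 := by
    intro c n hc h
    have h1 := hT.value_independent c (fun i => e i * n i) hc (by
      simpa only [hae, map_zpow₀, ← zpow_mul] using h)
    funext i
    have h2 : e i * n i = 0 := congrFun h1 i
    have h3 := he i
    rw [Pi.zero_apply, ← one_mul (n i), ← h3, mul_assoc, h2, mul_zero]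
  have hvz : ∀ n : Fin ρ ⊕ O → ℤ, V.valuation ((∏ i, z i ^ n i : Fˣ) : F) =
      V.valuation (algebraMap K F (∏ k : O, (t k : K) ^ n (Sum.inr k))) *
        ∏ i, V.valuation (a i : F) ^ n (Sum.inl i) := by
    intro n
    rw [Fintype.prod_sum_type, mul_comm]
    simp [z, map_prod, map_zpow₀, Units.coe_prod]
  have ht0' : ∀ n : O → ℤ, ∏ k : O, (t k : K) ^ n k ≠ 0 := fun n =>
    Finset.prod_ne_zero_iff.2 fun k _ => zpow_ne_zero _ fun h => ht0 k k.2 (Subtype.ext h)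
  refine ⟨z, hz, fun i => ?_, fun k => rfl, ?_, ?_, ?_⟩
  · refine ⟨a i ^ e i, zpow_mem (Subgroup.subset_closure (Set.mem_range.2 ⟨Sum.inl i, rfl⟩)) _, ?_⟩
    rw [Units.val_zpow_eq_zpow_val, hae, ← zpow_mul, he, zpow_one]
  · intro n hn
    have h1 : V.valuation ((∏ i, z i ^ n i : Fˣ) : F) = 1 := hn
    rw [hvz] at h1
    have h2 := hprod _ _ (ht0' _) h1
    have h3 : ∀ i, n (Sum.inl i) = 0 := congrFun h2
    simp only [h3, zpow_zero, Finset.prod_const_one, mul_one, map_prod, map_zpow₀] at h1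
    have h4 := hO (fun k => if h : k ∈ O then n (Sum.inr ⟨k, h⟩) else 0)
      (fun k hk => dif_neg hk) (by
      rw [← h1, ← (Equiv.Set.sumCompl O).prod_comp, Fintype.prod_sum_type]
      have h5 : ∀ k : ↥Oᶜ, (k : Fin d) ∉ O := fun k => k.2
      simp [h5])
    funext i
    rcases i with i | k
    · exact h3 i
    · have := congrFun h4 k
      simpa using this
  · rintro rfl n hn
    obtain ⟨c, hc, h⟩ := mem_baseValued.1 hn
    rw [hvz] at h
    have hvc : V.valuation (algebraMap K F c) ≠ 0 := by simpa using hc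
    have h2 := hprod ((∏ k : (∅ : Set (Fin d)), (t k : K) ^ n (Sum.inr k)) / c)
      (fun i => n (Sum.inl i))
      (div_ne_zero (ht0' _) hc) (by
        rw [map_div₀, map_div₀, div_mul_eq_mul_div, h, div_self hvc])
    funext i
    rcases i with i | k
    · exact congrFun h2 i
    · exact k.2.elim
  · have hG : polySubring S.toSubring (fun i => (a i : F)) (fun j => (y j : F)) ≤ V.toSubring :=
      polySubring_le_valuationSubring hS ha y
    have h1 := hasRegularParameters_polySubring hS t ht.2 (by rw [ht.1, Fintype.card_fin])
      (fun i => (a i : F)) ha y hT.residue_algebraicIndependent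
      (algebraicIndependent_of_valuation (fun i => (a i).ne_zero) hprod
        hT.residue_algebraicIndependent) hG
    have hloc := localizationAtCenter_eq_of_le hG (polySubring_le_valuationSubring hS hz y)
      (polySubring_le (fun c hc => algebraMap_mem_polySubring hc)
        (fun i => left_mem_polySubring (x := fun i => (z i : F)) (Sum.inl i))
        fun j => right_mem_polySubring j)
      ((polySubring_le (fun c hc => algebraMap_mem_polySubring hc) (by
        rintro (i | k)
        · exact left_mem_polySubring (x := fun i => (a i : F)) i
        · exact algebraMap_mem_polySubring (t k).2)
        fun j => right_mem_polySubring j).trans (le_localizationAtCenter hG))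
    rw [hloc]
    let f : (Fin ρ ⊕ O) ⊕ ↥Oᶜ ≃ Fin d ⊕ Fin ρ :=
      (Equiv.sumAssoc _ _ _).trans
        (((Equiv.refl _).sumCongr (Equiv.Set.sumCompl O)).trans (Equiv.sumComm _ _))
    have h2 := h1.comp_equiv f
    have h3 : Sum.elim (fun j => algebraMap K F (t j)) (fun i => (a i : F)) ∘ f =
        Sum.elim (fun i => (z i : F)) fun k : ↥Oᶜ => algebraMap K F (t k) := by
      funext i
      rcases i with (i | k) | k <;> simp [f, z]
    rwa [h3] at h2

end Initial

section Monomials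

variable {V : ValuationSubring F} {S : LocalSubring K} {d : ℕ} {t : Fin d → S.toSubring}
  {O : Set (Fin d)}

theorem valuation_algebraMap_unit (hS : S ≤ (restrict K V).toLocalSubring) (w : S.toSubringˣ) :
    V.valuation (algebraMap K F ((w : S.toSubring) : K)) = 1 := by
  refine le_antisymm ((V.valuation_le_one_iff _).2 (algebraMap_mem_of_le hS w.1.2)) ?_
  rw [← not_lt, ← valuation_restrict_lt_one_iff, ← mem_maximalIdeal_iff_valuation hS]
  exact fun h => h w.isUnit

/-- A monomial in the parameters `t` which is only divisible by the `t k` with `k ∈ O` is a unit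
times an element of the group generated by the `t k` with `k ∈ O`. -/
theorem IsMonomialIn.exists_eq_mul (hS : S ≤ (restrict K V).toLocalSubring) {H : Subgroup Fˣ}
    (hH : ∀ k ∈ O, ∃ a ∈ H, (a : F) = algebraMap K F (t k)) {c : S.toSubring}
    (hc : IsMonomialIn (Set.range t) c) (hcO : ∀ k, t k ∣ c → k ∈ O) :
    ∃ u : S.toSubring, V.valuation (algebraMap K F u) = 1 ∧
      ∃ a ∈ H, algebraMap K F c = algebraMap K F u * (a : F) := by
  obtain ⟨w, n, h, μ, hh, rfl⟩ := hc
  have key : ∀ i, ∃ a ∈ H, (a : F) = algebraMap K F (h i) ^ μ i := by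
    intro i
    obtain ⟨k, hk⟩ := hh i
    by_cases hμ : μ i = 0
    · exact ⟨1, H.one_mem, by simp [hμ]⟩
    · obtain ⟨a, ha, hak⟩ := hH k (hcO k (hk ▸ Dvd.dvd.mul_left
        ((dvd_pow_self _ hμ).trans
          (Finset.dvd_prod_of_mem (fun i => h i ^ μ i) (Finset.mem_univ i))) _))
      exact ⟨a ^ μ i, pow_mem ha _, by rw [Units.val_pow_eq_pow_val, hak, hk]⟩
  choose a ha hah using key
  refine ⟨w, valuation_algebraMap_unit hS w, ∏ i, a i, prod_mem fun i _ => ha i, ?_⟩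
  simp [Units.coe_prod, hah, map_prod]

end Monomials

/-! ### Monomialization -/

variable {V : ValuationSubring F} {ρ τ : ℕ} {x : Fin ρ → F} {y : Fin τ → V}
  {S : LocalSubring K} {d : ℕ} {t : Fin d → S.toSubring} {O : Set (Fin d)}

theorem coe_mem_polySubring_of_mem_closure {S : Subring K} {ι β : Type*} {z : ι → Fˣ} {y : β → F}
    {a : Fˣ} (ha : a ∈ Submonoid.closure (Set.range z)) :
    (a : F) ∈ polySubring S (fun i => (z i : F)) y := by
  induction ha using Submonoid.closure_induction with
  | mem a ha =>
    obtain ⟨i, rfl⟩ := ha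
    exact left_mem_polySubring (x := fun i => (z i : F)) i
  | one => exact one_mem _
  | mul a b _ _ ha hb => exact mul_mem ha hb

/-- Perron's algorithm, applied to the quotients of the terms of finitely many polynomials with
monomial coefficients, makes all integral quotients of these polynomials monomials in the resulting
parameters. -/
theorem exists_monomialization (hT : ConditionT K V x y)
    (hS : S ≤ (restrict K V).toLocalSubring) [IsNoetherianRing S.toSubring]
    (ht : IsRegularParameterSystem t) (ht0 : ∀ k ∈ O, t k ≠ 0)
    (hO : ∀ n : Fin d → ℤ, (∀ k, k ∉ O → n k = 0) →
      ∏ k, V.valuation (algebraMap K F (t k : K)) ^ n k = 1 → n = 0)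
    [Fintype O] [Fintype ↥Oᶜ] {Φ : Set (MvPolynomial (Fin ρ ⊕ Fin τ) S.toSubring)}
    (hΦ : Φ.Finite) (hΦ0 : ∀ f ∈ Φ, f ≠ 0)
    (hΦt : ∀ f ∈ Φ, ∀ c ∈ f.coeffs, IsMonomialIn (Set.range t) c)
    (hΦO : ∀ f ∈ Φ, ∀ c ∈ f.coeffs, ∀ k, t k ∣ c → k ∈ O) :
    ∃ (z : Fin ρ ⊕ O → Fˣ) (hz : ∀ i, unitsValuation V (z i) < 1),
      (∀ i, ∃ a ∈ Subgroup.closure (Set.range z), (a : F) = x i) ∧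
      (O = ∅ → IndepMod (baseValued K V) z) ∧
      HasRegularParameters (localizationAtCenter V _ (polySubring_le_valuationSubring hS hz y))
        (Sum.elim (fun i => (z i : F)) fun k : ↥Oᶜ => algebraMap K F (t k)) ∧
      ∀ f ∈ Φ, ∀ g ∈ Φ,
        evalAt S.toSubring x (fun j => (y j : F)) f / evalAt S.toSubring x (fun j => (y j : F)) g
          ∈ V →
        ∃ m ∈ Submonoid.closure (Set.range z),
          ∃ s ∈ (localizationAtCenter V _
            (polySubring_le_valuationSubring hS hz y)).toSubring, V.valuation s = 1 ∧
          evalAt S.toSubring x (fun j => (y j : F)) f /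
            evalAt S.toSubring x (fun j => (y j : F)) g = m * s := by
  classical
  obtain ⟨z₀, hz₀, hx₀, hzt, hi₀, hb₀, hreg₀⟩ := exists_initial_family (y := y) hT hS ht ht0 hO
  set H := Subgroup.closure (Set.range z₀) with hH
  -- every term of a polynomial in `Φ` is a unit times an element of `H` times a monomial in `y`
  have hterm : ∀ f m, ∃ (u : S.toSubring) (a : Fˣ), a ∈ H ∧ (f ∈ Φ → m ∈ f.support →
      V.valuation (algebraMap K F u) = 1 ∧
      algebraMap K F ((f.coeff m : S.toSubring) : K) * ∏ i, x i ^ m (Sum.inl i) =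
        algebraMap K F u * a) := by
    intro f m
    by_cases hfm : f ∈ Φ ∧ m ∈ f.support
    · obtain ⟨hf, hm⟩ := hfm
      have hc : f.coeff m ∈ f.coeffs := MvPolynomial.coeff_mem_coeffs m
        (MvPolynomial.mem_support_iff.1 hm)
      obtain ⟨u, hu, a, ha, hua⟩ := (hΦt f hf _ hc).exists_eq_mul hS (H := H) (O := O)
        (fun k hk => ⟨z₀ (Sum.inr ⟨k, hk⟩), Subgroup.subset_closure ⟨_, rfl⟩, hzt _⟩)
        (hΦO f hf _ hc)
      choose b hb hbx using hx₀
      refine ⟨u, a * ∏ i, b i ^ m (Sum.inl i),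
        mul_mem ha (prod_mem fun i _ => pow_mem (hb i) _), fun _ _ => ⟨hu, ?_⟩⟩
      rw [hua, Units.val_mul, Units.coe_prod, mul_assoc]
      simp [hbx]
    · exact ⟨1, 1, H.one_mem, fun hf hm => (hfm ⟨hf, hm⟩).elim⟩
  choose u E hEH hE using hterm
  let T : Set Fˣ := {a | (∃ f ∈ Φ, ∃ g ∈ Φ, ∃ m ∈ f.support, ∃ m' ∈ g.support,
    a = E f m / E g m') ∧ unitsValuation V a < 1}
  have hTfin : T.Finite := by
    refine Set.Finite.subset (s := ⋃ f ∈ Φ, ⋃ g ∈ Φ, ⋃ m ∈ f.support, ⋃ m' ∈ g.support,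
      {E f m / E g m'}) ?_ ?_
    · exact hΦ.biUnion fun f _ => hΦ.biUnion fun g _ => f.support.finite_toSet.biUnion fun m _ =>
        g.support.finite_toSet.biUnion fun m' _ => Set.finite_singleton _
    · rintro a ⟨⟨f, hf, g, hg, m, hm, m', hm', rfl⟩, -⟩
      simp only [Set.mem_iUnion]
      exact ⟨f, hf, g, hg, m, hm, m', hm', rfl⟩
  obtain ⟨z, hstep, hTz⟩ := exists_perronSteps hz₀ hi₀ hTfin (by
    rintro a ⟨⟨f, hf, g, hg, m, hm, m', hm', rfl⟩, ha⟩
    exact ⟨div_mem (hEH f m) (hEH g m'), ha⟩)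
  have hcl : Submonoid.closure (Set.range z₀) ≤ Submonoid.closure (Set.range z) :=
    (perronSteps_invariant (N := ⊥) hstep).2.2
  have hHz : H ≤ Subgroup.closure (Set.range z) := by
    rw [hH, Subgroup.closure_le]
    rintro _ ⟨i, rfl⟩
    exact Subgroup.le_closure_toSubmonoid _ (hcl (Submonoid.subset_closure ⟨i, rfl⟩))
  obtain ⟨hz, hreg⟩ := hasRegularParameters_perronSteps hS hstep hz₀ hreg₀
  have hGV := polySubring_le_valuationSubring hS hz y
  -- an integral quotient of terms has positive value, or is equal to one by independence
  have hquot : ∀ f ∈ Φ, ∀ g ∈ Φ, ∀ m ∈ f.support, ∀ m' ∈ g.support,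
      V.valuation (E f m / E g m' : F) ≤ 1 →
        E f m / E g m' ∈ Submonoid.closure (Set.range z) := by
    intro f hf g hg m hm m' hm' hv
    rw [← Units.val_div_eq_div_val] at hv
    rcases hv.lt_or_eq with hv | hv
    · exact hTz _ ⟨⟨f, hf, g, hg, m, hm, m', hm', rfl⟩, hv⟩
    · rw [hi₀.eq_one_of_mem (div_mem (hEH f m) (hEH g m')) hv]
      exact one_mem _
  have hzloc : ∀ a ∈ Submonoid.closure (Set.range z),
      (a : F) ∈ (localizationAtCenter V _ hGV).toSubring := fun a ha =>
    le_localizationAtCenter hGV (coe_mem_polySubring_of_mem_closure ha)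
  have heval : ∀ f ∈ Φ, ∃ m ∈ f.support,
      ∃ s ∈ (localizationAtCenter V _ hGV).toSubring, V.valuation s = 1 ∧
        evalAt S.toSubring x (fun j => (y j : F)) f = E f m * s := fun f hf =>
    exists_evalAt_eq_mul hT.ne_zero hT.value_independent
      hT.residue_algebraicIndependent (hΦ0 f hf)
      (fun j => le_localizationAtCenter hGV (right_mem_polySubring j))
      (fun m => algebraMap K F (u f m)) (E f)
      (fun m _ => le_localizationAtCenter hGV (algebraMap_mem_polySubring (u f m).2))
      (fun m hm => (hE f m hf hm).1) (fun m hm => (hE f m hf hm).2)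
      (fun m hm m' hm' hv => by
        have := hzloc _ (hquot f hf f hf m hm m' hm' hv)
        rwa [Units.val_div_eq_div_val] at this)
  refine ⟨z, hz, fun i => ?_, fun h => (perronSteps_invariant hstep).1 (hb₀ h), hreg, ?_⟩
  · obtain ⟨a, ha, h⟩ := hx₀ i
    exact ⟨a, hHz ha, h⟩
  · intro f hf g hg hfg
    obtain ⟨m, hm, s, hs, hs1, hfs⟩ := heval f hf
    obtain ⟨m', hm', s', hs', hs1', hgs⟩ := heval g hg
    have h1 : evalAt S.toSubring x (fun j => (y j : F)) f /
        evalAt S.toSubring x (fun j => (y j : F)) g = ((E f m / E g m' : Fˣ) : F) * (s / s') := by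
      rw [hfs, hgs, Units.val_div_eq_div_val]
      exact mul_div_mul_comm _ _ _ _
    refine ⟨E f m / E g m', hquot f hf g hg m hm m' hm' ?_, s / s', ?_, ?_, h1⟩
    · rw [h1, ← V.valuation_le_one_iff, map_mul, map_div₀ _ s, hs1, hs1', div_one, mul_one,
        Units.val_div_eq_div_val] at hfg
      exact hfg
    · rw [div_eq_mul_inv]
      exact mul_mem hs (inv_mem_localizationAtCenter hGV hs' hs1')
    · rw [map_div₀, hs1, hs1', div_one]

theorem HasRegularParameters.isPartOfRegularParameterSystem {A : LocalSubring F} {J : Type*}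
    [Fintype J] {b : J → F} (h : HasRegularParameters A b) {n : ℕ} (f : Fin n ↪ J) :
    IsPartOfRegularParameterSystem fun i => (⟨b (f i), h.mem _⟩ : A.toSubring) := by
  refine ⟨Fintype.card J, fun i => ⟨b ((Fintype.equivFin J).symm i), h.mem _⟩,
    f.trans (Fintype.equivFin J).toEmbedding, ⟨h.ringKrullDim_eq, ?_⟩, fun i => by simp⟩
  rw [← h.span_eq]
  congr 1
  exact (Fintype.equivFin J).symm.surjective.range_comp
    (fun j => (⟨b j, h.mem j⟩ : A.toSubring))

/-- A unit times a product of elements of `H` is a monomial in `H`. -/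
theorem isMonomialIn_of_mem_closure {O : Type*} [CommRing O] {n : ℕ} (a : Fin n → O) {m s : O}
    (hm : m ∈ Submonoid.closure (Set.range a)) (hs : IsUnit s) :
    IsMonomialIn (Set.range a) (m * s) := by
  obtain ⟨μ, rfl⟩ := Submonoid.exists_of_mem_closure_range _ _ hm
  obtain ⟨w, rfl⟩ := hs
  exact ⟨w, n, a, μ, fun i => ⟨i, rfl⟩, mul_comm _ _⟩

/-! ### Coordinate rings of the models -/

section FractionField

variable {V : ValuationSubring F} {ρ τ : ℕ} {x : Fin ρ → F} {y : Fin τ → V}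

/-- A subring of `F` that contains `R` and `y` and a family generating the `x i` multiplicatively
has fraction field `F = K(x, y)`. -/
theorem ConditionT.isFractionRing (hT : ConditionT K V x y) {R : Subring K} [IsFractionRing R K]
    {G : Subring F} (hRG : ∀ c ∈ R, algebraMap K F c ∈ G) {ι : Type*} {z : ι → Fˣ}
    (hzG : ∀ i, (z i : F) ∈ G) (hyG : ∀ j, (y j : F) ∈ G)
    (hxz : ∀ i, ∃ a ∈ Subgroup.closure (Set.range z), (a : F) = x i) : IsFractionRing G F := by
  let L := Subfield.closure (G : Set F)
  have hGL : ∀ a ∈ G, a ∈ L := fun a ha => Subfield.subset_closure ha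
  have hzL : ∀ a ∈ Subgroup.closure (Set.range z), (a : F) ∈ L := by
    intro a ha
    induction ha using Subgroup.closure_induction with
    | mem a ha =>
      obtain ⟨i, rfl⟩ := ha
      exact hGL _ (hzG i)
    | one => exact one_mem L
    | mul a b _ _ ha hb => exact mul_mem ha hb
    | inv a _ ha =>
      rw [Units.val_inv_eq_inv_val]
      exact inv_mem ha
  have hL : L = ⊤ := by
    have h1 := congrArg IntermediateField.toSubfield hT.adjoin_eq_top
    rw [IntermediateField.adjoin_toSubfield, IntermediateField.top_toSubfield] at h1
    refine top_le_iff.1 (h1 ▸ Subfield.closure_le.2 ?_)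
    rintro _ (⟨c, rfl⟩ | ⟨i, rfl⟩ | ⟨j, rfl⟩)
    · obtain ⟨p, q, -, rfl⟩ := IsFractionRing.div_surjective (A := R) c
      rw [map_div₀]
      exact div_mem (hGL _ (hRG _ p.2)) (hGL _ (hRG _ q.2))
    · obtain ⟨a, ha, h⟩ := hxz i
      exact h ▸ hzL a ha
    · exact hGL _ (hyG j)
  refine IsFractionRing.of_field _ _ fun w => ?_
  have hw : w ∈ Subfield.closure (G : Set F) := by
    change w ∈ L
    rw [hL]
    trivial
  obtain ⟨a, ha, b, hb, hab⟩ := Subfield.mem_closure_iff.1 hw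
  rw [Subring.closure_eq] at ha hb
  exact ⟨⟨a, ha⟩, ⟨b, hb⟩, hab.symm⟩

end FractionField

section Transforms

/-- A field has no monoidal transform, as its only prime has height zero. -/
theorem IsMonoidalTransform.ne_top {v : ValuationSubring K} {R R₁ : LocalSubring K}
    (h : IsMonoidalTransform v R R₁) : R.toSubring ≠ ⊤ := by
  rintro hR
  obtain ⟨p, -, hp, hht, -⟩ := h
  have hF : IsField R.toSubring := by
    rw [hR]
    exact (Subring.topEquiv (R := K)).toMulEquiv.isField (Field.toIsField K)
  let := hF.toField
  rcases eq_or_ne p ⊥ with rfl | hp0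
  · simp at hht
  · exact hp.ne_top ((Ideal.eq_bot_or_top p).resolve_left hp0)

theorem IsIteratedMonoidalTransform.eq_of_eq_top {v : ValuationSubring K} {R R' : LocalSubring K}
    (h : IsIteratedMonoidalTransform v R R') (hR : R.toSubring = ⊤) : R' = R := by
  induction h using Relation.ReflTransGen.head_induction_on with
  | refl => rfl
  | head h _ _ => exact (h.ne_top hR).elim

theorem ringKrullDim_of_eq_top {R : Subring K} (hR : R = ⊤) : ringKrullDim R = 0 := by
  subst hR
  rw [ringKrullDim_eq_of_ringEquiv (Subring.topEquiv (R := K))]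
  exact ringKrullDim_eq_zero_of_field K

end Transforms

section Sandwich

variable {V : ValuationSubring F} {R : LocalSubring K}

/-- The center of the place on the affine model with coordinate ring `G` inherits regularity and
dimension from the localization of `G`, which may be presented as that of another ring. -/
theorem stalk_affineCenter_of_eq {G : Subring F} {A : LocalSubring F} (hRG : ∀ c : R.toSubring,
      algebraMap K F c ∈ G)
    (hft : (((algebraMap K F).comp R.toSubring.subtype).codRestrict G hRG).FiniteType)
    [IsFractionRing G F] (hG : G ≤ V.toSubring) (hA : localizationAtCenter V G hG = A)
    [IsRegularLocalRing A.toSubring] :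
    IsRegularLocalRing ((affineModel hRG hft).X.presheaf.stalk (affineCenter hRG hft hG)) ∧
    (affineModel hRG hft).localRing (affineCenter hRG hft hG) = A ∧
    ringKrullDim ((affineModel hRG hft).X.presheaf.stalk (affineCenter hRG hft hG)) =
      ringKrullDim A.toSubring := by
  subst hA
  exact ⟨.of_ringEquiv (stalkAffineCenterEquiv hRG hft hG).symm, localRing_affineCenter hRG hft hG,
    ringKrullDim_eq_of_ringEquiv (stalkAffineCenterEquiv hRG hft hG)⟩

/-- If `S` is the local ring of `R[s]` at the center of the place, then `S[z, y]` and `R[s, z, y]`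
have the same local ring at the center. -/
theorem localizationAtCenter_polySubring_eq {S : LocalSubring K} {s : Set K}
    (hs : Subring.closure ((R.toSubring : Set K) ∪ s) ≤ (restrict K V).toSubring)
    (hS : S = localizationAtCenter (restrict K V) _ hs) {ι β : Type*} {z : ι → F} {y : β → F}
    (hP : polySubring S.toSubring z y ≤ V.toSubring) :
    ∃ hG : polySubring R.toSubring (Sum.elim (fun a : s => algebraMap K F a) z) y ≤ V.toSubring,
      localizationAtCenter V _ hG = localizationAtCenter V _ hP := by
  set G := polySubring R.toSubring (Sum.elim (fun a : s => algebraMap K F a) z) y with hGdef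
  have hC : ∀ c ∈ Subring.closure ((R.toSubring : Set K) ∪ s), algebraMap K F c ∈ G := by
    have : Subring.closure ((R.toSubring : Set K) ∪ s) ≤ G.comap (algebraMap K F) := by
      rw [Subring.closure_le]
      rintro c (hc | hc)
      · exact algebraMap_mem_polySubring hc
      · exact left_mem_polySubring (x := Sum.elim (fun a : s => algebraMap K F a) z)
          (Sum.inl ⟨c, hc⟩)
    exact this
  have hCS : ∀ c ∈ Subring.closure ((R.toSubring : Set K) ∪ s), c ∈ S.toSubring := fun c hc =>
    hS ▸ le_localizationAtCenter hs hc
  have hzG : ∀ i, z i ∈ G := fun i =>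
    left_mem_polySubring (x := Sum.elim (fun a : s => algebraMap K F a) z) (Sum.inr i)
  have hGP : G ≤ polySubring S.toSubring z y := by
    refine polySubring_le (fun c hc => algebraMap_mem_polySubring (hCS c
      (Subring.subset_closure (.inl hc)))) ?_ fun j => right_mem_polySubring j
    rintro (a | i)
    · exact algebraMap_mem_polySubring (hCS a (Subring.subset_closure (.inr a.2)))
    · exact left_mem_polySubring i
  have hG : G ≤ V.toSubring := hGP.trans hP
  refine ⟨hG, (localizationAtCenter_eq_of_le hG hP hGP (polySubring_le (fun c hc => ?_)
    (fun i => le_localizationAtCenter hG (hzG i))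
    fun j => le_localizationAtCenter hG (right_mem_polySubring j))).symm⟩
  rw [hS] at hc
  obtain ⟨a, ha, b, hb, hb1, rfl⟩ := (mem_localizationAtCenter hs).1 hc
  have hb1' : V.valuation (algebraMap K F b) = 1 := by
    refine le_antisymm ((V.valuation_le_one_iff _).2 (hG (hC b hb))) ?_
    rw [← not_lt, ← valuation_restrict_lt_one_iff, hb1]
    exact lt_irrefl _
  exact (mem_localizationAtCenter hG).2 ⟨_, hC a ha, _, hC b hb, hb1', map_div₀ _ _ _⟩

end Sandwich

section Parameters

variable {V : ValuationSubring F} {R : LocalSubring K} {ρ τ : ℕ} {x : Fin ρ → F} {y : Fin τ → V}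
  {Z : Set F}

theorem NCData.t_ne_zero (D : NCData V R x (fun j => (y j : F)) Z) {k : Fin D.d}
    (hk : k ∈ D.occurring) : D.t k ≠ 0 := by
  obtain ⟨ζ, c, hc, hk⟩ := hk
  intro h0
  rw [h0, zero_dvd_iff] at hk
  rcases hc with hc | hc <;> exact (MvPolynomial.mem_coeffs_iff.1 hc).elim fun m hm =>
    (MvPolynomial.mem_support_iff.1 hm.1) (hm.2 ▸ hk)

/-- Local parameters `z` which generate, with the non-occurring `t k`, the maximal ideal of the
local ring of `R'[z, y]`, and in which all elements of `Z` are monomials. -/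
theorem NCData.exists_parameters (D : NCData V R x (fun j => (y j : F)) Z)
    (hT : ConditionT K V x y) (hS : D.R' ≤ (restrict K V).toLocalSubring) (hZ : Z.Finite)
    (hZV : Z ⊆ (V : Set F)) (hV : D.ConditionV) [Fintype D.occurring] [Fintype ↥D.occurringᶜ] :
    ∃ (z : Fin ρ ⊕ D.occurring → Fˣ) (hz : ∀ i, unitsValuation V (z i) < 1),
      (∀ i, ∃ a ∈ Subgroup.closure (Set.range z), (a : F) = x i) ∧
      (D.occurring = ∅ → IndepMod (baseValued K V) z) ∧
      HasRegularParameters (localizationAtCenter V _ (polySubring_le_valuationSubring hS hz y))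
        (Sum.elim (fun i => (z i : F)) fun k : ↥D.occurringᶜ => algebraMap K F (D.t k)) ∧
      ∀ ζ ∈ Z, ∃ m ∈ Submonoid.closure (Set.range z),
        ∃ s ∈ (localizationAtCenter V _ (polySubring_le_valuationSubring hS hz y)).toSubring,
          V.valuation s = 1 ∧ ζ = m * s := by
  have hreg := D.regular
  have := hZ.to_subtype
  obtain ⟨z, hz, hxz, hbase, hpar, hmono⟩ := exists_monomialization (O := D.occurring) hT hS
    D.isRegularParameterSystem (fun k => D.t_ne_zero) hV
    (Φ := Set.range D.num ∪ Set.range D.den)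
    ((Set.finite_range _).union (Set.finite_range _))
    (by
      rintro _ (⟨ζ, rfl⟩ | ⟨ζ, rfl⟩)
      exacts [D.num_ne_zero ζ, D.den_ne_zero ζ])
    (by
      rintro _ (⟨ζ, rfl⟩ | ⟨ζ, rfl⟩)
      exacts [D.num_coeff ζ, D.den_coeff ζ])
    (by
      rintro _ (⟨ζ, rfl⟩ | ⟨ζ, rfl⟩) c hc k hk
      exacts [⟨ζ, c, .inl hc, hk⟩, ⟨ζ, c, .inr hc, hk⟩])
  refine ⟨z, hz, hxz, hbase, hpar, fun ζ hζ => ?_⟩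
  have h := D.eq_div ⟨ζ, hζ⟩
  obtain ⟨m, hm, s, hs, hs1, hms⟩ := hmono _ (.inl ⟨⟨ζ, hζ⟩, rfl⟩) _ (.inr ⟨⟨ζ, hζ⟩, rfl⟩)
    (h ▸ hZV hζ)
  exact ⟨m, hm, s, hs, hs1, h.trans hms⟩

end Parameters

end Uniformization

open Uniformization

theorem theorem4p1 {K F : Type u} [Field K] [Field F] [Algebra K F]
    -- the place, given by its valuation ring
    (V : ValuationSubring F)
    {ρ τ : ℕ} (x : Fin ρ → F) (y : Fin τ → V)
    (hT : Uniformization.ConditionT K V x y)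
    (R : LocalSubring K) [IsRegularLocalRing R.toSubring] [IsFractionRing R.toSubring K]
    (hcat : Uniformization.IsUniversallyCatenary R.toSubring)
    (hdom : R ≤ (Uniformization.restrict K V).toLocalSubring)
    (Z : Set F) (hZ : Z.Finite) (hZV : Z ⊆ (V : Set F))
    (D : Uniformization.NCData V R x (fun j => (y j : F)) Z) (hV : D.ConditionV) :
    (∃ (R' : LocalSubring K) (x' : Fin (ρ + D.delta) → F),
      Uniformization.IsIteratedMonoidalTransform (Uniformization.restrict K V) R R' ∧
      IsRegularLocalRing R'.toSubring ∧
      (D.delta : WithBot ℕ∞) ≤ ringKrullDim R'.toSubring ∧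
      (∀ i, x' i ∈ V) ∧
      ∃ hA : Uniformization.generatedSubring R' x' (fun j => (y j : F)) ≤ V.toSubring,
        let Aq := (Uniformization.localizationAtCenter V _ hA).toSubring
        IsRegularLocalRing Aq ∧
        ringKrullDim Aq = ringKrullDim R'.toSubring + (ρ : WithBot ℕ∞) ∧
        (∃ a : Fin (ρ + D.delta) → Aq, (∀ i, (a i : F) = x' i) ∧
          Uniformization.IsPartOfRegularParameterSystem a ∧
          ∀ ζ ∈ Z, ∃ hζ : ζ ∈ Aq, Uniformization.IsMonomialIn (Set.range a) ⟨ζ, hζ⟩)) ∧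
    (∃ (𝒳 : Uniformization.Model R F) (p : 𝒳.X),
      𝒳.IsCenter V p ∧ IsRegularLocalRing (𝒳.X.presheaf.stalk p) ∧
      Z ⊆ ((𝒳.localRing p).toSubring : Set F) ∧
      ringKrullDim (𝒳.X.presheaf.stalk p) ≤ ringKrullDim R.toSubring + (ρ : WithBot ℕ∞)) ∧
    (R.toSubring = ⊤ →
      ∃ (𝒳 : Uniformization.Model R F) (p : 𝒳.X),
        𝒳.IsAffineSpace (ρ + τ) ∧
        𝒳.IsCenter V p ∧ IsRegularLocalRing (𝒳.X.presheaf.stalk p) ∧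
        Z ⊆ ((𝒳.localRing p).toSubring : Set F) ∧
        ringKrullDim (𝒳.X.presheaf.stalk p) = (ρ : WithBot ℕ∞)) := by
  classical
  have hreg := D.regular
  obtain ⟨s, hsfin, hs, hSs⟩ := exists_finite_of_isIteratedMonoidalTransform hdom D.iterated
  have hS : D.R' ≤ (restrict K V).toLocalSubring := hSs ▸ localizationAtCenter_le hs
  obtain ⟨z, hz, hxz, hbase, hpar, hζ⟩ := D.exists_parameters hT hS hZ hZV hV
  have hP := polySubring_le_valuationSubring hS hz y
  set A := localizationAtCenter V _ hP with hA
  have hAreg : IsRegularLocalRing A.toSubring := hpar.isRegularLocalRing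
  have hdimA : ringKrullDim A.toSubring = ringKrullDim D.R'.toSubring + (ρ : WithBot ℕ∞) := by
    rw [hpar.ringKrullDim_eq, D.isRegularParameterSystem.1, Fintype.card_sum, Fintype.card_sum,
      add_assoc, ← Fintype.card_sum (α := D.occurring),
      Fintype.card_congr (Equiv.Set.sumCompl D.occurring), Fintype.card_fin, Fintype.card_fin]
    push_cast
    exact add_comm _ _
  have hzA : ∀ a ∈ Submonoid.closure (Set.range z), (a : F) ∈ A.toSubring := fun a ha =>
    le_localizationAtCenter hP (coe_mem_polySubring_of_mem_closure ha)
  have hZA : Z ⊆ (A.toSubring : Set F) := by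
    intro ζ h
    obtain ⟨m, hm, s, hs, -, rfl⟩ := hζ ζ h
    exact mul_mem (hzA m hm) hs
  refine ⟨?_, ?_, ?_⟩
  · let e : Fin (ρ + D.delta) ≃ Fin ρ ⊕ D.occurring :=
      finSumFinEquiv.symm.trans ((Equiv.refl _).sumCongr (Finite.equivFinOfCardEq rfl).symm)
    let x' : Fin (ρ + D.delta) → F := fun i => z (e i)
    -- `x'` is an enumeration of `z`, so that `R'[x', y] = R'[z, y]`
    have hgen : generatedSubring D.R' x' (fun j => (y j : F)) =
        polySubring D.R'.toSubring (fun i => (z i : F)) (fun j => (y j : F)) := by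
      have h1 : Set.range x' = Set.range fun i => (z i : F) :=
        e.surjective.range_comp fun i => (z i : F)
      rw [generatedSubring, polySubring, h1]
    have hA' : generatedSubring D.R' x' (fun j => (y j : F)) ≤ V.toSubring := hgen.trans_le hP
    have hloc : localizationAtCenter V _ hA' = A :=
      localizationAtCenter_eq_of_le hP hA' hgen.ge (hgen.le.trans (le_localizationAtCenter hP))
    have hδ : (D.delta : WithBot ℕ∞) ≤ ringKrullDim D.R'.toSubring := by
      rw [D.isRegularParameterSystem.1]
      have : D.delta ≤ D.d := by
        have := Set.ncard_le_card D.occurring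
        rwa [Nat.card_eq_fintype_card, Fintype.card_fin] at this
      exact_mod_cast this
    refine ⟨D.R', x', D.iterated, D.regular, hδ, fun i => hP (left_mem_polySubring (e i)), hA', ?_⟩
    rw [hloc]
    refine ⟨hAreg, hdimA, fun i => ⟨x' i, hpar.mem (Sum.inl (e i))⟩, fun i => rfl,
      hpar.isPartOfRegularParameterSystem (e.toEmbedding.trans Function.Embedding.inl), ?_⟩
    intro ζ h
    refine ⟨hZA h, ?_⟩
    obtain ⟨m, hm, s, hsA, hs1, rfl⟩ := hζ ζ h
    have hsu : IsUnit (⟨s, hsA⟩ : A.toSubring) := IsUnit.of_mul_eq_one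
      ⟨s⁻¹, inv_mem_localizationAtCenter hP hsA hs1⟩ (Subtype.ext (mul_inv_cancel₀ (by
        rintro rfl
        simp at hs1)))
    refine isMonomialIn_of_mem_closure (m := (⟨m, hzA m hm⟩ : A.toSubring)) _ ?_ hsu
    obtain ⟨μ, rfl⟩ := Submonoid.exists_of_mem_closure_range _ _ hm
    have h1 : (⟨((∏ i, z i ^ μ i : Fˣ) : F), hzA _ hm⟩ : A.toSubring) =
        ∏ i, (⟨z i, hpar.mem (Sum.inl i)⟩ : A.toSubring) ^ μ i := Subtype.ext (by
      change _ = A.toSubring.subtype _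
      simp [Units.coe_prod])
    rw [h1]
    exact prod_mem fun i _ => pow_mem (Submonoid.subset_closure
      (Set.mem_range.2 ⟨e.symm i, by simp [x']⟩)) _
  · obtain ⟨hG, hloc⟩ := localizationAtCenter_polySubring_eq hs hSs hP
    have := hsfin.to_subtype
    have hFrac := hT.isFractionRing (R := R.toSubring) (z := z)
      (G := polySubring R.toSubring (Sum.elim (fun a : s => algebraMap K F a)
        fun i => (z i : F)) fun j => (y j : F))
      (fun c hc => algebraMap_mem_polySubring hc)
      (fun i => left_mem_polySubring (x := Sum.elim (fun a : s => algebraMap K F a)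
        fun i => (z i : F)) (Sum.inr i)) (fun j => right_mem_polySubring j) hxz
    obtain ⟨h1, h2, h3⟩ := stalk_affineCenter_of_eq
      (fun c : R.toSubring => algebraMap_mem_polySubring c.2)
      (finiteType_polySubring R.toSubring _ _) hG hloc
    refine ⟨_, _, isCenter_affineCenter _ _ hG, h1, by rwa [h2], ?_⟩
    rw [h3, hdimA]
    refine add_le_add_left ?_ _
    have hC := ringKrullDim_localizationAtCenter_le hs
    rw [← hSs] at hC
    exact hC.trans (ringKrullDim_closure_union_le _ hsfin)
  · intro hR
    -- over a field there are no transforms and no parameters `t k`, so that `z` has length `ρ`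
    have hSR : D.R' = R := D.iterated.eq_of_eq_top hR
    have hSR' : D.R'.toSubring = ⊤ := by rw [hSR, hR]
    have hd : D.d = 0 := by
      have h1 := D.isRegularParameterSystem.1
      rw [ringKrullDim_of_eq_top hSR'] at h1
      exact_mod_cast h1.symm
    have hocc : D.occurring = ∅ := Set.eq_empty_iff_forall_notMem.2 fun k => (hd ▸ k).elim0
    have hPR : polySubring R.toSubring (fun i => (z i : F)) (fun j => (y j : F)) =
        polySubring D.R'.toSubring (fun i => (z i : F)) (fun j => (y j : F)) := by rw [hSR]
    have hG := hPR.trans_le hP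
    have hloc : localizationAtCenter V _ hG = A :=
      localizationAtCenter_eq_of_le hP hG hPR.ge (hPR.le.trans (le_localizationAtCenter hP))
    have hFrac := hT.isFractionRing (R := R.toSubring) (z := z)
      (G := polySubring R.toSubring (fun i => (z i : F)) fun j => (y j : F))
      (fun c hc => algebraMap_mem_polySubring hc)
      (fun i => left_mem_polySubring (x := fun i => (z i : F)) i)
      (fun j => right_mem_polySubring j) hxz
    obtain ⟨h1, h2, h3⟩ := stalk_affineCenter_of_eq
      (fun c : R.toSubring => algebraMap_mem_polySubring c.2)
      (finiteType_polySubring R.toSubring _ _) hG hloc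
    have hind : AlgebraicIndependent K (Sum.elim (fun i => (z i : F)) fun j => (y j : F)) := by
      refine algebraicIndependent_of_valuation (fun i => (z i).ne_zero) (fun c n hc h => ?_)
        hT.residue_algebraicIndependent
      refine hbase hocc n (mem_baseValued.2 ⟨c⁻¹, inv_ne_zero hc, ?_⟩)
      rw [map_inv₀, map_inv₀]
      refine eq_inv_of_mul_eq_one_right ?_
      simpa [Units.coe_prod, map_prod] using h
    have hcard : Fintype.card D.occurring = 0 := by simp [hocc]
    obtain ⟨e, he⟩ := exists_mvPolynomial_equiv_polySubring R.toSubring hind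
    let f : ULift.{u} (Fin (ρ + τ)) ≃ (Fin ρ ⊕ D.occurring) ⊕ Fin τ :=
      Fintype.equivOfCardEq (by simp [hcard])
    refine ⟨_, _, isAffineSpace_affineModel _ _ ((MvPolynomial.renameEquiv _ f).toRingEquiv.trans e)
      (fun c => (he _).trans (by simp)), isCenter_affineCenter _ _ hG, h1, by rwa [h2], ?_⟩
    rw [h3, hdimA, ringKrullDim_of_eq_top hSR', zero_add]
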